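/- A strict partition is a finite strictly decreasing sequence of positive integers $\mu=(\mu_1>\mu_2>\cdots>\mu_\ell)$ (possibly empty), with size $|\mu|=\sum_i\mu_i$, length $\ell(\mu)=\ell$, and $\mu_i=0$ for $i>\ell$. It is identified with its shifted Young diagram, the set of boxes $(i,j)$ with $1\le i\le\ell$ and $i+1\le j\le i+\mu_i$. The content of a box $\square=(i,j)$ is $c_\square=j-i$, and its hook length is the number of boxes to the right of it in row $i$, plus the number of boxes below it in column $j$, plus $1$ for the box itself, plus $\mu_j$. Let $H_\mu$ be the product of the hook lengths of all boxes of $\mu$. For strict partitions write $\lambda\supseteq\mu$ if $\lambda_i\ge\mu_i$ for all $i$; then $\lambda/\mu$ is the set of boxes of $\lambda$ not in $\mu$, $|\lambda/\mu|=|\lambda|-|\mu|$, and $f_{\lambda/\mu}$ is the number of standard shifted Young tableaux of shape $\lambda/\mu$, i.e. of bijections from $\lambda/\mu$ to $\{1,\dots,|\lambda/\mu|\}$ that increase along rows and down columns. The outer corners of $\mu$ are the boxes whose removal leaves the diagram of a strict partition; list them as $(\alpha_1,\beta_1),\dots,(\alpha_m,\beta_m)$ with $\alpha_1>\cdots>\alpha_m$,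 and put $\alpha_{m+1}=0$, $\beta_0=\ell(\mu)+1$. Let $y_j=\beta_j-\alpha_j$ for $1\le j\le m$ and $x_i=\beta_i-\alpha_{i+1}$ for $0\le i\le m$ be the contents of the outer corners and of the inner corners $(\alpha_{i+1},\beta_i)$, and define $$q_k(\mu)=\sum_{i=0}^m\binom{x_i}{2}^k-\sum_{j=1}^m\binom{y_j}{2}^k .$$ Theorem. Let $\mu$ be a strict partition and $n\ge 0$ an integer. Then $$\sum_{|\lambda/\mu|=n}\frac{2^{|\lambda|-\ell(\lambda)-|\mu|+\ell(\mu)}f_{\lambda/\mu}H_\mu}{H_\lambda}\Bigl(\sum_{\square\in\lambda}\binom{c_\square+1}{4}-\sum_{\square\in\mu}\binom{c_\square+1}{4}\Bigr)=\frac23\binom n3+\frac23|\mu|\binom n2+\frac1{12}\bigl(q_2(\mu)+|\mu|^2-2|\mu|\bigr)n,$$ where the sum ranges over all strict partitions $\lambda\supseteq\mu$ with $|\lambda/\mu|=n$. -/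

import Mathlib

/-- A strict partition: a finite strictly decreasing sequence of positive integers. -/
structure StrictPartition where
  parts : List ℕ
  strict : parts.Pairwise (fun a b => b < a)
  pos : ∀ p ∈ parts, 0 < p

namespace StrictPartition

/-- The size, i.e. the sum of the parts. -/
def size (μ : StrictPartition) : ℕ := μ.parts.sum

/-- The length, i.e. the number of parts. -/
def length (μ : StrictPartition) : ℕ := μ.parts.length

/-- The `i`-th part, counted from `1`; it is `0` for `i` beyond the length (and for the
unused index `i = 0`). -/
def row (μ : StrictPartition) : ℕ → ℕ
  | 0 => 0
  | i + 1 => μ.parts.getD i 0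

/-- The shifted Young diagram: row `i` (counted from `1`) occupies the columns
`i + 1, …, i + μ_i`. -/
def boxes (μ : StrictPartition) : Finset (ℕ × ℕ) :=
  (Finset.Icc 1 μ.length).biUnion fun i => {i} ×ˢ Finset.Icc (i + 1) (i + μ.row i)

/-- The content `j - i` of the box `(i, j)`. It is only used for boxes with `i < j`, so the
subtraction of natural numbers does not truncate. -/
def content (b : ℕ × ℕ) : ℕ := b.2 - b.1

/-- The hook length of the box `b = (i, j)`: the number of boxes to the right of it, plus the
number of boxes below it, plus one for the box itself, plus the `j`-th part. -/
def hookLength (μ : StrictPartition) (b : ℕ × ℕ) : ℕ :=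
  (μ.boxes.filter fun a => a.1 = b.1 ∧ b.2 < a.2).card
    + (μ.boxes.filter fun a => a.2 = b.2 ∧ b.1 < a.1).card + 1 + μ.row b.2

/-- The product `H_μ` of all hook lengths. -/
def hookProd (μ : StrictPartition) : ℕ := ∏ b ∈ μ.boxes, μ.hookLength b

/-- `Contains ν μ` means `ν ⊇ μ`, i.e. `ν_i ≥ μ_i` for all `i`. -/
def Contains (ν μ : StrictPartition) : Prop := ∀ i, μ.row i ≤ ν.row i

/-- The skew shifted diagram `ν/μ`. -/
def skewBoxes (ν μ : StrictPartition) : Finset (ℕ × ℕ) := ν.boxes \ μ.boxes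

/-- The standard shifted Young tableaux of shape `ν/μ`: bijective fillings of the boxes with
`0, …, N - 1`, `N` the number of boxes, that increase strictly along rows and down columns. -/
def SkewTableau (ν μ : StrictPartition) : Type :=
  {T : skewBoxes ν μ ≃ Fin (skewBoxes ν μ).card //
    (∀ a b : skewBoxes ν μ, a.1.1 = b.1.1 → a.1.2 < b.1.2 → T a < T b) ∧
    (∀ a b : skewBoxes ν μ, a.1.2 = b.1.2 → a.1.1 < b.1.1 → T a < T b)}

/-- The number `f_{ν/μ}` of standard shifted Young tableaux of shape `ν/μ`. -/
noncomputable def numTableaux (ν μ : StrictPartition) : ℕ := Nat.card (SkewTableau ν μ)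

open Classical in
/-- The outer corners: the boxes whose removal leaves the diagram of a strict partition. -/
noncomputable def outerCorners (μ : StrictPartition) : Finset (ℕ × ℕ) :=
  μ.boxes.filter fun b => ∃ ν : StrictPartition, ν.boxes = μ.boxes.erase b

/-- The inner corners. If the outer corners are `(α_1, β_1), …, (α_m, β_m)` with
`α_1 > ⋯ > α_m`, and `α_{m+1} = 0`, `β_0 = ℓ + 1`, these are `(α_{i+1}, β_i)` for `0 ≤ i ≤ m`.
Here `α_1` is the largest row of an outer corner, and `α_{i+1}` is the largest row of an outer
corner that is smaller than `α_i`; either is `0` if there is none. -/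
noncomputable def innerCorners (μ : StrictPartition) : Finset (ℕ × ℕ) :=
  insert (μ.outerCorners.sup Prod.fst, μ.length + 1)
    (μ.outerCorners.image fun b =>
      ((μ.outerCorners.filter fun a => a.1 < b.1).sup Prod.fst, b.2))

/-- `q_k(μ)`: the sum of `binom(x, 2)^k` over the contents `x` of the inner corners, minus
the sum of `binom(y, 2)^k` over the contents `y` of the outer corners. -/
noncomputable def q (k : ℕ) (μ : StrictPartition) : ℚ :=
  ∑ b ∈ μ.innerCorners, (((content b).choose 2 : ℕ) : ℚ) ^ k
    - ∑ b ∈ μ.outerCorners, (((content b).choose 2 : ℕ) : ℚ) ^ k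

theorem finite_size_eq (N : ℕ) : {ν : StrictPartition | ν.size = N}.Finite := by
  refine Set.Finite.of_finite_image (f := fun ν : StrictPartition => ν.parts.toFinset)
    ((Finset.finite_toSet (Finset.range (N + 1)).powerset).subset ?_) ?_
  · rintro _ ⟨ν, hν, rfl⟩
    simp only [Finset.coe_powerset, Set.mem_preimage, Set.mem_powerset_iff]
    intro p hp
    have hp' : p ∈ ν.parts := by simpa using hp
    have h1 : p ≤ ν.parts.sum := List.single_le_sum (fun _ _ => Nat.zero_le _) p hp'
    have h2 : ν.parts.sum = N := hν
    simp only [Finset.coe_range, Set.mem_Iio]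
    omega
  · rintro ⟨l, hl, hl'⟩ - ⟨k, hk, hk'⟩ - h
    have h' : l.toFinset = k.toFinset := h
    have hln : l.Nodup := hl.imp fun hab => (ne_of_lt hab).symm
    have hkn : k.Nodup := hk.imp fun hab => (ne_of_lt hab).symm
    have hp : l.Perm k := List.perm_of_nodup_nodup_toFinset_eq hln hkn h'
    have : l = k := hp.eq_of_pairwise (fun a b _ _ h1 h2 => absurd h1 (not_lt.mpr h2.le)) hl hk
    subst this
    rfl

/-- The strict partitions `ν ⊇ μ` with `|ν/μ| = n`. -/
noncomputable def extensions (μ : StrictPartition) (n : ℕ) : Finset StrictPartition :=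
  ((finite_size_eq (μ.size + n)).subset
    (fun _ h => h.2 : {ν : StrictPartition | ν.Contains μ ∧ ν.size = μ.size + n} ⊆ _)).toFinset

end StrictPartition

namespace StrictPartition

/-! Give a row of length `a` the node `X = a(a+1)/2` and the root `Y = a(a-1)/2`, and add the node
`0` of the empty row below the diagram. A product formula for `H_μ` shows that adding a box to row
`i` multiplies `2^(|μ|-ℓ(μ)) / H_μ` by `∏ (X_i - Y_j) / ∏_{j ≠ i} (X_i - X_j)`
(`IsRaise.relWeight_eq`). Where no box can be added, row `i - 1` is exactly one longer, so `Y_{i-1}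
= X_i` and the factor vanishes. Hence summing a function `g(X_i)` against these weights over all
one-box extensions gives the divided difference of `g(z) ∏ (z - Y_j)` at all nodes
(`sum_relWeight_mul`).

For `g = 1, z, z^2` the divided differences are `1`, `|μ|` and `(|μ|^2 + q_2(μ))/2`
(`dividedDiff_prod_moments`), because `X_j - Y_j = μ_j`, `X_j^2 - Y_j^2 = μ_j^3`, and `q_2(μ) = ∑
μ_j^3` after telescoping over runs of rows between corners. The value `1` makes the weights behave
like transition probabilities of a growth process. A new box with node `X` raises the content sum by
`(X^2 - X)/6` and `q_2` by `6X + 1`, both at most quadratic in `X`, so their mean increments are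
known exactly.

Deleting the largest entry of a tableau gives a recursion for `f_{λ/μ}`, which turns the sum over
extensions by `n + 1` boxes into a one-step sum inside the sum for `n` boxes (`weightedSum_succ`).
Induction on `n` yields first the mean of `q_2` and then that of the content sum. -/

/-! ### Strict partitions as row functions -/

theorem row_zero (μ : StrictPartition) : μ.row 0 = 0 := rfl

theorem row_succ (μ : StrictPartition) (i : ℕ) : μ.row (i + 1) = μ.parts.getD i 0 := rfl

theorem row_pos_iff (μ : StrictPartition) (i : ℕ) : 0 < μ.row i ↔ 1 ≤ i ∧ i ≤ μ.length := by
  rcases i with _ | i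
  · simp [row_zero]
  · rw [row_succ]
    by_cases h : i < μ.parts.length
    · rw [List.getD_eq_getElem _ _ h]
      have := μ.pos _ (List.getElem_mem h)
      simp only [length]
      omega
    · rw [List.getD_eq_default _ _ (not_lt.mp h)]
      simp only [length]
      omega

theorem row_eq_zero (μ : StrictPartition) {i : ℕ} (h : μ.length < i) : μ.row i = 0 := by
  have := (μ.row_pos_iff i).not
  omega

theorem row_lt_row (μ : StrictPartition) {i j : ℕ} (hi : 1 ≤ i) (hl : i ≤ μ.length)
    (hij : i < j) : μ.row j < μ.row i := by
  by_cases hj : j ≤ μ.length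
  · obtain ⟨i, rfl⟩ := Nat.exists_eq_add_of_le' hi
    obtain ⟨j, rfl⟩ := Nat.exists_eq_add_of_le' (hi.trans hij.le)
    have hi' : i < μ.parts.length := hl
    have hj' : j < μ.parts.length := hj
    rw [row_succ, row_succ, List.getD_eq_getElem _ _ hi', List.getD_eq_getElem _ _ hj']
    exact List.pairwise_iff_getElem.mp μ.strict i j hi' hj' (by omega)
  · rw [μ.row_eq_zero (not_le.mp hj)]
    exact (μ.row_pos_iff i).mpr ⟨hi, hl⟩

theorem row_succ_lt_or (μ : StrictPartition) {i : ℕ} (hi : 1 ≤ i) :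
    μ.row (i + 1) < μ.row i ∨ μ.row i = 0 ∧ μ.row (i + 1) = 0 := by
  by_cases h : i ≤ μ.length
  · exact Or.inl (μ.row_lt_row hi h (Nat.lt_succ_self i))
  · exact Or.inr ⟨μ.row_eq_zero (by omega), μ.row_eq_zero (by omega)⟩

/-- Parts drop by at least one per row, so the last column `i + μ.row i` of row `i` is weakly
decreasing. -/
theorem row_add_le (μ : StrictPartition) {i j : ℕ} (hi : 1 ≤ i) (hij : i ≤ j)
    (hj : j ≤ μ.length) : j + μ.row j ≤ i + μ.row i := by
  induction j, hij using Nat.le_induction with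
  | base => exact le_rfl
  | succ k hk ih =>
    have h1 := ih (by omega)
    have h2 := μ.row_lt_row (i := k) (j := k + 1) (by omega) (by omega) (by omega)
    omega

theorem mem_boxes (μ : StrictPartition) (b : ℕ × ℕ) :
    b ∈ μ.boxes ↔ b.1 < b.2 ∧ b.2 ≤ b.1 + μ.row b.1 := by
  obtain ⟨i, j⟩ := b
  simp only [boxes, Finset.mem_biUnion, Finset.mem_product, Finset.mem_singleton, Finset.mem_Icc]
  constructor
  · rintro ⟨k, hk, rfl, h⟩
    omega
  · rintro ⟨h1, h2⟩
    have := (μ.row_pos_iff i).mp (by omega)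
    exact ⟨i, this, rfl, by omega⟩

theorem length_eq_of_row (μ : StrictPartition) {L : ℕ}
    (h : ∀ i, 1 ≤ i → (0 < μ.row i ↔ i ≤ L)) : μ.length = L := by
  apply le_antisymm
  · by_contra hc
    have := (h μ.length (by omega)).mp ((μ.row_pos_iff _).mpr (by omega))
    omega
  · rcases Nat.eq_zero_or_pos L with h0 | h0
    · omega
    · exact ((μ.row_pos_iff L).mp ((h L h0).mpr le_rfl)).2

theorem ext_row {μ ν : StrictPartition} (h : ∀ i, μ.row i = ν.row i) : μ = ν := by
  have hl : μ.length = ν.length :=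
    μ.length_eq_of_row fun i hi => by rw [h, row_pos_iff]; omega
  have hp : μ.parts = ν.parts := by
    refine List.ext_getElem hl fun i h1 h2 => ?_
    have := h (i + 1)
    rwa [row_succ, row_succ, List.getD_eq_getElem _ _ h1, List.getD_eq_getElem _ _ h2] at this
  cases μ; cases ν; cases hp; rfl

theorem _root_.List.sum_eq_sum_range_getD (l : List ℕ) {L : ℕ} (hL : l.length ≤ L) :
    l.sum = ∑ i ∈ Finset.range L, l.getD i 0 := by
  induction l generalizing L with
  | nil => simp
  | cons a l ih =>
    obtain ⟨L, rfl⟩ := Nat.exists_eq_add_of_le' (Nat.one_le_iff_ne_zero.mpr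
      (by simp only [List.length_cons] at hL; omega : L ≠ 0))
    rw [Finset.sum_range_succ', List.sum_cons, ih (L := L) (by simpa using hL)]
    simp [add_comm]

theorem size_eq_sum_row (μ : StrictPartition) {L : ℕ} (hL : μ.length ≤ L) :
    μ.size = ∑ i ∈ Finset.Icc 1 L, μ.row i := by
  rw [size, List.sum_eq_sum_range_getD _ hL]
  clear hL
  induction L with
  | zero => simp
  | succ L ih => rw [Finset.sum_range_succ, Finset.sum_Icc_succ_top (by omega), ih, row_succ]

theorem exists_row_eq (r : ℕ → ℕ) (h0 : r 0 = 0)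
    (h : ∀ i, 1 ≤ i → r (i + 1) < r i ∨ r i = 0 ∧ r (i + 1) = 0) :
    ∃ ν : StrictPartition, ∀ i, ν.row i = r i := by
  have hz : ∃ L, r (L + 1) = 0 := by
    by_contra hc
    push Not at hc
    -- Without a zero, `r` would decrease strictly forever, starting from `r 1`.
    have key : ∀ k, r (k + 1) + k ≤ r 1 := by
      intro k
      induction k with
      | zero => simp
      | succ k ih =>
        rcases h (k + 1) (by omega) with h1 | h1
        · omega
        · exact absurd h1.1 (hc k)
    have := key (r 1)
    have := hc (r 1)
    omega
  classical
  have hL := Nat.find_spec hz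
  have hmin : ∀ m, m < Nat.find hz → r (m + 1) ≠ 0 := fun m hm => Nat.find_min hz hm
  generalize Nat.find hz = L at hL hmin
  have hpos : ∀ i, L < i → r i = 0 := by
    intro i hi
    induction i, hi using Nat.le_induction with
    | base => exact hL
    | succ k hk ih => rcases h k (by omega) with h1 | h1 <;> omega
  have hlt : ∀ i j, i < j → j < L → r (j + 1) < r (i + 1) := by
    intro i j hij hj
    induction j, hij using Nat.le_induction with
    | base =>
      rcases h (i + 1) (by omega) with h1 | h1
      · exact h1
      · exact absurd h1.1 (hmin i (by omega))
    | succ k hk ih =>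
      have := ih (by omega)
      rcases h (k + 1) (by omega) with h1 | h1
      · omega
      · exact absurd h1.1 (hmin k (by omega))
  refine ⟨⟨(List.range L).map fun i => r (i + 1), ?_, ?_⟩, ?_⟩
  · rw [List.pairwise_iff_getElem]
    intro i j hi hj hij
    simp only [List.length_map, List.length_range] at hi hj
    simpa using hlt i j hij hj
  · intro p hp
    simp only [List.mem_map, List.mem_range] at hp
    obtain ⟨i, hi, rfl⟩ := hp
    exact Nat.pos_of_ne_zero (hmin i hi)
  · rintro (_ | i)
    · exact h0.symm
    · rw [row_succ]
      by_cases hi : i < L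
      · rw [List.getD_eq_getElem _ _ (by simpa using hi)]
        simp
      · rw [List.getD_eq_default _ _ (by simpa using hi), hpos _ (by omega)]

theorem mem_extensions (μ ν : StrictPartition) (n : ℕ) :
    ν ∈ μ.extensions n ↔ ν.Contains μ ∧ ν.size = μ.size + n := by
  simp [extensions]

theorem Contains.length_le {μ ν : StrictPartition} (h : ν.Contains μ) :
    μ.length ≤ ν.length := by
  rcases Nat.eq_zero_or_pos μ.length with h0 | h0
  · omega
  · have := (μ.row_pos_iff μ.length).mpr ⟨h0, le_rfl⟩
    exact ((ν.row_pos_iff _).mp (this.trans_le (h _))).2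


/-! ### Adding and removing one box -/

/-- `ν` arises from `μ` by adding one box at the end of row `i`. -/
def IsRaise (μ : StrictPartition) (i : ℕ) (ν : StrictPartition) : Prop :=
  ν.row = Function.update μ.row i (μ.row i + 1)

theorem IsRaise.row_self {μ ν : StrictPartition} {i : ℕ} (h : μ.IsRaise i ν) :
    ν.row i = μ.row i + 1 := by
  rw [h, Function.update_self]

theorem IsRaise.row_of_ne {μ ν : StrictPartition} {i j : ℕ} (h : μ.IsRaise i ν) (hj : j ≠ i) :
    ν.row j = μ.row j := by
  rw [h, Function.update_of_ne hj]

theorem IsRaise.one_le {μ ν : StrictPartition} {i : ℕ} (h : μ.IsRaise i ν) : 1 ≤ i := by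
  by_contra hi
  obtain rfl : i = 0 := by omega
  have := h.row_self
  simp [row_zero] at this

theorem IsRaise.le_length_succ {μ ν : StrictPartition} {i : ℕ} (h : μ.IsRaise i ν) :
    i ≤ μ.length + 1 := by
  by_contra hi
  have h1 : ν.row (i - 1) = 0 := by rw [h.row_of_ne (by omega), μ.row_eq_zero (by omega)]
  have h2 : i ≤ ν.length := ((ν.row_pos_iff i).mp (by rw [h.row_self]; omega)).2
  have h3 := (ν.row_pos_iff (i - 1)).mpr (by omega)
  omega

theorem IsRaise.length_eq_of_le {μ ν : StrictPartition} {i : ℕ} (h : μ.IsRaise i ν)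
    (hi : i ≤ μ.length) : ν.length = μ.length := by
  refine ν.length_eq_of_row fun j hj => ?_
  by_cases hji : j = i
  · subst hji
    rw [h.row_self]
    omega
  · rw [h.row_of_ne hji, row_pos_iff]
    omega

theorem IsRaise.length_eq_of_eq {μ ν : StrictPartition} {i : ℕ} (h : μ.IsRaise i ν)
    (hi : i = μ.length + 1) : ν.length = μ.length + 1 := by
  refine ν.length_eq_of_row fun j hj => ?_
  by_cases hji : j = i
  · subst hji
    rw [h.row_self]
    omega
  · rw [h.row_of_ne hji, row_pos_iff]
    omega

theorem IsRaise.length_le {μ ν : StrictPartition} {i : ℕ} (h : μ.IsRaise i ν) :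
    ν.length ≤ μ.length + 1 := by
  have := h.le_length_succ
  rcases Nat.lt_or_ge μ.length i with h1 | h1
  · exact (h.length_eq_of_eq (by omega)).le
  · exact (h.length_eq_of_le h1).le.trans (by omega)

theorem IsRaise.contains {μ ν : StrictPartition} {i : ℕ} (h : μ.IsRaise i ν) :
    ν.Contains μ := by
  intro j
  by_cases hji : j = i
  · subst hji
    rw [h.row_self]
    omega
  · rw [h.row_of_ne hji]

/-- The range goes up to `μ.length + 1` so that one formula covers both lengthening a row and
starting a new one. -/
theorem IsRaise.sum_eq {μ ν : StrictPartition} {i : ℕ} (h : μ.IsRaise i ν)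
    {M : Type*} [AddCommGroup M] (g : ℕ → M) :
    ∑ j ∈ Finset.Icc 1 (μ.length + 1), g (ν.row j)
      = ∑ j ∈ Finset.Icc 1 (μ.length + 1), g (μ.row j) + (g (μ.row i + 1) - g (μ.row i)) := by
  have hi : i ∈ Finset.Icc 1 (μ.length + 1) := Finset.mem_Icc.mpr ⟨h.one_le, h.le_length_succ⟩
  rw [← Finset.add_sum_erase _ _ hi, ← Finset.add_sum_erase _ (fun j => g (μ.row j)) hi,
    h.row_self, Finset.sum_congr rfl fun j hj => by rw [h.row_of_ne (Finset.ne_of_mem_erase hj)]]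
  abel

theorem IsRaise.size_eq {μ ν : StrictPartition} {i : ℕ} (h : μ.IsRaise i ν) :
    ν.size = μ.size + 1 := by
  have := h.sum_eq (fun a => (a : ℤ))
  rw [← Nat.cast_sum, ← Nat.cast_sum, ← ν.size_eq_sum_row h.length_le,
    ← μ.size_eq_sum_row (Nat.le_succ _)] at this
  push_cast at this
  omega

theorem exists_isRaise_of_mem_extensions {μ ν : StrictPartition} (h : ν ∈ μ.extensions 1) :
    ∃ i, μ.IsRaise i ν := by
  obtain ⟨hc, hs⟩ := (mem_extensions _ _ _).mp h
  rw [ν.size_eq_sum_row le_rfl, μ.size_eq_sum_row hc.length_le] at hs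
  obtain ⟨i, hi, hne⟩ : ∃ i ∈ Finset.Icc 1 ν.length, μ.row i ≠ ν.row i := by
    by_contra hcon
    push Not at hcon
    have heq : ∑ i ∈ Finset.Icc 1 ν.length, μ.row i = ∑ i ∈ Finset.Icc 1 ν.length, ν.row i :=
      Finset.sum_congr rfl hcon
    omega
  have hlt : μ.row i < ν.row i := lt_of_le_of_ne (hc i) hne
  rw [← Finset.add_sum_erase _ _ hi, ← Finset.add_sum_erase _ μ.row hi] at hs
  have hle : ∑ j ∈ (Finset.Icc 1 ν.length).erase i, μ.row j
      ≤ ∑ j ∈ (Finset.Icc 1 ν.length).erase i, ν.row j := Finset.sum_le_sum fun j _ => hc j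
  have heq := (Finset.sum_eq_sum_iff_of_le fun j _ => hc j).mp
    (by omega : ∑ j ∈ (Finset.Icc 1 ν.length).erase i, μ.row j
      = ∑ j ∈ (Finset.Icc 1 ν.length).erase i, ν.row j)
  refine ⟨i, funext fun j => ?_⟩
  by_cases hji : j = i
  · subst hji
    rw [Function.update_self]
    omega
  · rw [Function.update_of_ne hji]
    by_cases hj : 1 ≤ j ∧ j ≤ ν.length
    · exact (heq j (Finset.mem_erase.mpr ⟨hji, Finset.mem_Icc.mpr hj⟩)).symm
    · have h1 := (ν.row_pos_iff j).not.mpr hj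
      have h2 := hc j
      omega

theorem IsRaise.mem_extensions {μ ν : StrictPartition} {i : ℕ} (h : μ.IsRaise i ν) :
    ν ∈ μ.extensions 1 :=
  (StrictPartition.mem_extensions _ _ _).mpr ⟨h.contains, h.size_eq⟩

theorem IsRaise.boxes_eq {μ ν : StrictPartition} {i : ℕ} (h : μ.IsRaise i ν) :
    ν.boxes = insert (i, i + μ.row i + 1) μ.boxes := by
  ext ⟨j, k⟩
  simp only [mem_boxes, Finset.mem_insert, Prod.mk.injEq]
  by_cases hji : j = i
  · subst hji
    rw [h.row_self]
    omega
  · rw [h.row_of_ne hji]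
    omega

theorem IsRaise.notMem_boxes (μ : StrictPartition) (i : ℕ) :
    (i, i + μ.row i + 1) ∉ μ.boxes := by
  rw [mem_boxes]
  dsimp only
  omega

theorem exists_isRaise (μ : StrictPartition) {i : ℕ} (hi : 1 ≤ i) (hl : i ≤ μ.length + 1)
    (h : i = 1 ∨ μ.row i + 1 < μ.row (i - 1)) : ∃ ν, μ.IsRaise i ν := by
  obtain ⟨ν, hν⟩ := exists_row_eq (Function.update μ.row i (μ.row i + 1))
    (by rw [Function.update_of_ne (by omega), row_zero]) (by
      intro j hj
      have h1 := μ.row_succ_lt_or hj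
      by_cases hji : j = i
      · subst hji
        rw [Function.update_self, Function.update_of_ne (by omega)]
        omega
      · rw [Function.update_of_ne hji]
        by_cases hji' : j + 1 = i
        · subst hji'
          rw [Function.update_self]
          simp only [Nat.add_sub_cancel] at h
          omega
        · rw [Function.update_of_ne hji']
          exact h1)
  exact ⟨ν, funext hν⟩

/-- The case `ν.row i = 1` is separate because the strict gap fails there, although the row may
simply disappear. -/
theorem exists_isRaise_of_lower (ν : StrictPartition) {i : ℕ} (h0 : 0 < ν.row i)
    (h : ν.row i = 1 ∨ ν.row (i + 1) + 1 < ν.row i) : ∃ κ : StrictPartition, κ.IsRaise i ν := by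
  have hi := (ν.row_pos_iff i).mp h0
  obtain ⟨κ, hκ⟩ := exists_row_eq (Function.update ν.row i (ν.row i - 1))
    (by rw [Function.update_of_ne (by omega), row_zero]) (by
      intro j hj
      have h1 := ν.row_succ_lt_or hj
      by_cases hji : j = i
      · subst hji
        rw [Function.update_self, Function.update_of_ne (by omega)]
        omega
      · rw [Function.update_of_ne hji]
        by_cases hji' : j + 1 = i
        · subst hji'
          rw [Function.update_self]
          omega
        · rw [Function.update_of_ne hji']
          exact h1)
  refine ⟨κ, funext fun j => ?_⟩
  by_cases hji : j = i
  · subst hji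
    rw [Function.update_self, hκ, Function.update_self]
    omega
  · rw [Function.update_of_ne hji, hκ, Function.update_of_ne hji]

end StrictPartition

/-! ### Divided differences -/

section DividedDifferences

variable {ι K : Type*} [DecidableEq ι] [Field K]

/-- The divided difference of `g` at the nodes `x i`, `i ∈ s`. -/
def dividedDiff (s : Finset ι) (x : ι → K) (g : K → K) : K :=
  ∑ i ∈ s, g (x i) / ∏ j ∈ s.erase i, (x i - x j)

theorem dividedDiff_add (s : Finset ι) (x : ι → K) (g h : K → K) :
    dividedDiff s x (fun z => g z + h z) = dividedDiff s x g + dividedDiff s x h := by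
  simp only [dividedDiff, add_div, Finset.sum_add_distrib]

theorem dividedDiff_const_mul (s : Finset ι) (x : ι → K) (c : K) (g : K → K) :
    dividedDiff s x (fun z => c * g z) = c * dividedDiff s x g := by
  simp only [dividedDiff, mul_div_assoc, Finset.mul_sum]

theorem dividedDiff_sub_mul {s : Finset ι} {x : ι → K} (hx : Set.InjOn x s) {a : ι} (ha : a ∈ s)
    (g : K → K) :
    dividedDiff s x (fun z => (z - x a) * g z) = dividedDiff (s.erase a) x g := by
  rw [dividedDiff, ← Finset.add_sum_erase _ _ ha, sub_self, zero_mul, zero_div, zero_add,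
    dividedDiff]
  refine Finset.sum_congr rfl fun i hi => ?_
  have hia := Finset.ne_of_mem_erase hi
  have hne : x i - x a ≠ 0 :=
    sub_ne_zero.mpr fun h => hia (hx (Finset.mem_of_mem_erase hi) ha h)
  rw [← Finset.mul_prod_erase (s.erase i) _ (Finset.mem_erase.mpr ⟨hia.symm, ha⟩),
    Finset.erase_right_comm, mul_div_mul_left _ _ hne]

/-- Write `z - y = (z - x a) + (x a - y)`; the first factor cancels the node `a`. All evaluations
below iterate this recursion. -/
theorem dividedDiff_sub_mul' {s : Finset ι} {x : ι → K} (hx : Set.InjOn x s) {a : ι} (ha : a ∈ s)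
    (y : K) (g : K → K) :
    dividedDiff s x (fun z => (z - y) * g z)
      = dividedDiff (s.erase a) x g + (x a - y) * dividedDiff s x g := by
  rw [← dividedDiff_sub_mul hx ha, ← dividedDiff_const_mul, ← dividedDiff_add]
  congr 1
  ext z
  ring

theorem dividedDiff_one {s : Finset ι} {x : ι → K} (hx : Set.InjOn x s) (hs : 1 < s.card) :
    dividedDiff s x (fun _ => 1) = 0 := by
  induction hn : s.card using Nat.strong_induction_on generalizing s with
  | _ n ih =>
    obtain ⟨a, ha, b, hb, hab⟩ := Finset.one_lt_card.mp hs
    have hne : x b - x a ≠ 0 := sub_ne_zero.mpr fun h => hab (hx ha hb h.symm)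
    have key : ∀ c ∈ s, dividedDiff (s.erase c) x (fun _ => (1 : K))
        = if s.card = 2 then 1 else 0 := by
      intro c hc
      have hcard := Finset.card_erase_of_mem hc
      split_ifs with h2
      · obtain ⟨d, hd⟩ := Finset.card_eq_one.mp (by omega : (s.erase c).card = 1)
        rw [hd]
        simp [dividedDiff]
      · exact ih _ (by omega) (hx.mono (Finset.coe_subset.mpr (Finset.erase_subset _ _)))
          (by omega) rfl
    -- The divided difference of `z - x a` is computed by removing `a` and by removing `b`. The two
    -- reduced values agree, so `(x b - x a)` times the wanted quantity is zero.
    have h1 := dividedDiff_sub_mul' hx hb (x a) (fun _ => (1 : K))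
    rw [dividedDiff_sub_mul hx ha, key a ha, key b hb] at h1
    exact (mul_eq_zero.mp (left_eq_add.mp h1)).resolve_left hne

/-- Divided differences annihilate polynomials of degree below the number of nodes minus one; each
factor costs one node. -/
theorem dividedDiff_prod_eq_zero {κ : Type*} [DecidableEq κ] {s : Finset ι} {x : ι → K}
    (hx : Set.InjOn x s) (u : Finset κ) (y : κ → K) (hs : u.card + 1 < s.card) :
    dividedDiff s x (fun z => ∏ j ∈ u, (z - y j)) = 0 := by
  induction u using Finset.induction_on generalizing s with
  | empty => simpa using dividedDiff_one hx (by simpa using hs)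
  | insert b u hb ih =>
    rw [Finset.card_insert_of_notMem hb] at hs
    obtain ⟨a, ha⟩ : s.Nonempty := Finset.card_pos.mp (by omega)
    simp only [Finset.prod_insert hb]
    have hcard := Finset.card_erase_of_mem ha
    rw [dividedDiff_sub_mul' hx ha,
      ih (hx.mono (Finset.coe_subset.mpr (Finset.erase_subset _ _))) (by omega),
      ih hx (by omega), mul_zero, add_zero]

/-- One root per node, except for the extra node `o` at zero, which does not contribute to the power
sums. The induction adds a node together with its root; the factor 2 in the last identity avoids a
division in `K`. -/
theorem dividedDiff_prod_moments {s : Finset ι} {o : ι} (ho : o ∉ s) {x : ι → K} (y : ι → K)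
    (hx : Set.InjOn x (insert o s : Finset ι)) (hxo : x o = 0) :
    dividedDiff (insert o s) x (fun z => ∏ j ∈ s, (z - y j)) = 1
      ∧ dividedDiff (insert o s) x (fun z => z * ∏ j ∈ s, (z - y j)) = ∑ j ∈ s, (x j - y j)
      ∧ 2 * dividedDiff (insert o s) x (fun z => z * (z * ∏ j ∈ s, (z - y j)))
        = (∑ j ∈ s, (x j - y j)) ^ 2 + ∑ j ∈ s, (x j ^ 2 - y j ^ 2) := by
  induction s using Finset.induction_on with
  | empty => simp [dividedDiff, hxo]
  | insert b s hb ih =>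
    have hob : o ≠ b := fun h => ho (h ▸ Finset.mem_insert_self _ _)
    have hos : o ∉ s := fun h => ho (Finset.mem_insert_of_mem h)
    have hmem : b ∈ insert o (insert b s) := by simp
    have her : (insert o (insert b s)).erase b = insert o s := by
      rw [Finset.erase_insert_of_ne hob, Finset.erase_insert hb]
    obtain ⟨h0, h1, h2⟩ := ih hos (hx.mono (by
      rw [Finset.coe_subset, ← her]
      exact Finset.erase_subset _ _))
    have step := fun (w : K) (g : K → K) => dividedDiff_sub_mul' hx hmem w g
    rw [her] at step
    have e0 : dividedDiff (insert o (insert b s)) x (fun z => ∏ j ∈ s, (z - y j)) = 0 := by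
      refine dividedDiff_prod_eq_zero hx s y ?_
      rw [Finset.card_insert_of_notMem ho, Finset.card_insert_of_notMem hb]
      omega
    have e1 : dividedDiff (insert o (insert b s)) x (fun z => z * ∏ j ∈ s, (z - y j)) = 1 := by
      have := step 0 (fun z => ∏ j ∈ s, (z - y j))
      simp only [sub_zero] at this
      rw [this, h0, e0, mul_zero, add_zero]
    have e2 : dividedDiff (insert o (insert b s)) x (fun z => z * (z * ∏ j ∈ s, (z - y j)))
        = ∑ j ∈ s, (x j - y j) + x b := by
      have := step 0 (fun z => z * ∏ j ∈ s, (z - y j))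
      simp only [sub_zero] at this
      rw [this, h1, e1, mul_one]
    simp only [Finset.prod_insert hb, Finset.sum_insert hb]
    refine ⟨?_, ?_, ?_⟩
    · rw [step, h0, e0, mul_zero, add_zero]
    · simp only [mul_left_comm _ (_ - y b)]
      rw [step, h1, e1]
      ring
    · simp only [mul_left_comm _ (_ - y b)]
      rw [step, e2, mul_add, h2]
      ring

end DividedDifferences

/-! ### The product formula for hook lengths -/

namespace StrictPartition

theorem hookLength_eq (μ : StrictPartition) {i j : ℕ} (hij : i < j) :
    μ.hookLength (i, j) = (i + μ.row i - j)
      + ((Finset.Ioc i μ.length).filter fun k => k < j ∧ j ≤ k + μ.row k).card + 1 + μ.row j := by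
  have h1 : (μ.boxes.filter fun a => a.1 = i ∧ j < a.2) = {i} ×ˢ Finset.Ioc j (i + μ.row i) := by
    ext ⟨a, b⟩
    simp only [Finset.mem_filter, mem_boxes, Finset.mem_product, Finset.mem_singleton,
      Finset.mem_Ioc]
    constructor
    · rintro ⟨h, rfl, h'⟩
      omega
    · rintro ⟨rfl, h⟩
      omega
  have h2 : (μ.boxes.filter fun a => a.2 = j ∧ i < a.1)
      = ((Finset.Ioc i μ.length).filter fun k => k < j ∧ j ≤ k + μ.row k) ×ˢ {j} := by
    ext ⟨a, b⟩
    simp only [Finset.mem_filter, mem_boxes, Finset.mem_product, Finset.mem_singleton,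
      Finset.mem_Ioc]
    constructor
    · rintro ⟨h, rfl, h'⟩
      have := (μ.row_pos_iff a).mp (by omega)
      omega
    · rintro ⟨h, rfl⟩
      omega
  simp only [hookLength, h1, h2, Finset.card_product, Finset.card_singleton, Nat.card_Ioc,
    one_mul, mul_one]

/-- For a column `j` within the length, the boxes below `(i, j)` are exactly those in rows strictly
between `i` and `j`, so the dependence on `j` as a column index cancels. -/
theorem hookLength_of_le_length (μ : StrictPartition) {i j : ℕ} (hi : 1 ≤ i) (hij : i < j)
    (hj : j ≤ μ.length) : μ.hookLength (i, j) = μ.row i + μ.row j := by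
  have hf : ((Finset.Ioc i μ.length).filter fun k => k < j ∧ j ≤ k + μ.row k)
      = Finset.Ioo i j := by
    ext k
    simp only [Finset.mem_filter, Finset.mem_Ioc, Finset.mem_Ioo]
    constructor
    · omega
    · rintro ⟨h1, h2⟩
      have := μ.row_add_le (i := k) (by omega) h2.le hj
      omega
  have := μ.row_add_le hi hij.le hj
  have := (μ.row_pos_iff j).mpr ⟨by omega, hj⟩
  rw [μ.hookLength_eq hij, hf, Nat.card_Ioo]
  omega

/-- The number `c` of boxes below `(i, j)`, for a column `j` beyond the length. -/
theorem exists_hookLength_eq (μ : StrictPartition) {i j : ℕ} (hi : 1 ≤ i) (hil : i ≤ μ.length)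
    (hj : μ.length < j) :
    ∃ c, i + c ≤ μ.length ∧ μ.hookLength (i, j) = (i + μ.row i - j) + c + 1 ∧
      ∀ k, i < k → k ≤ μ.length → (j ≤ k + μ.row k ↔ k ≤ i + c) := by
  have hsub : ((Finset.Ioc i μ.length).filter fun k => k < j ∧ j ≤ k + μ.row k).card
      ≤ μ.length - i := by
    simpa using Finset.card_filter_le (Finset.Ioc i μ.length) fun k => k < j ∧ j ≤ k + μ.row k
  refine ⟨_, ?_, by rw [μ.hookLength_eq (by omega), μ.row_eq_zero hj, add_zero], ?_⟩
  · omega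
  · intro k hik hk
    constructor
    · intro h
      have : Finset.Ioc i k ⊆
          (Finset.Ioc i μ.length).filter fun k => k < j ∧ j ≤ k + μ.row k := by
        intro m hm
        rw [Finset.mem_Ioc] at hm
        have := μ.row_add_le (i := m) (by omega) hm.2 hk
        simp only [Finset.mem_filter, Finset.mem_Ioc]
        omega
      have := Finset.card_le_card this
      rw [Nat.card_Ioc] at this
      omega
    · intro h
      by_contra hc
      have : ((Finset.Ioc i μ.length).filter fun k => k < j ∧ j ≤ k + μ.row k)
          ⊆ Finset.Ioo i k := by
        intro m hm
        simp only [Finset.mem_filter, Finset.mem_Ioc] at hm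
        rw [Finset.mem_Ioo]
        refine ⟨hm.1.1, ?_⟩
        by_contra hmk
        have := μ.row_add_le (i := k) (j := m) (by omega) (by omega) hm.1.2
        omega
      have := Finset.card_le_card this
      rw [Nat.card_Ioo] at this
      omega

/-- Hooks in columns up to the length are the sums `μ_i + μ_k`. The remaining hooks of row `i`,
together with the differences `μ_i - μ_k` for `k > i`, are a permutation of `1, …, μ_i`. -/
theorem prod_hookLength_row (μ : StrictPartition) {i : ℕ} (hi : 1 ≤ i) (hil : i ≤ μ.length) :
    (∏ j ∈ Finset.Icc (i + 1) (i + μ.row i), μ.hookLength (i, j))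
        * ∏ k ∈ Finset.Ioc i μ.length, (μ.row i - μ.row k)
      = (μ.row i).factorial * ∏ k ∈ Finset.Ioc i μ.length, (μ.row i + μ.row k) := by
  have hle : μ.length ≤ i + μ.row i := by
    have := μ.row_add_le hi hil le_rfl
    omega
  have hsplit : ∀ g : ℕ → ℕ, ∏ j ∈ Finset.Icc (i + 1) (i + μ.row i), g j
      = (∏ j ∈ Finset.Ioc i μ.length, g j) * ∏ j ∈ Finset.Ioc μ.length (i + μ.row i), g j := by
    intro g
    rw [← Finset.prod_union (by
      rw [Finset.disjoint_left]
      intro k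
      simp only [Finset.mem_Ioc]
      omega)]
    refine Finset.prod_congr ?_ fun _ _ => rfl
    ext k
    simp only [Finset.mem_union, Finset.mem_Ioc, Finset.mem_Icc]
    omega
  -- The columns `j ≤ μ.length` are free to index the differences, so `φ` lists both families over
  -- the `μ_i` columns of the row. Injectivity into `1, …, μ_i` then suffices by counting.
  let φ : ℕ → ℕ := fun j => if j ≤ μ.length then μ.row i - μ.row j else μ.hookLength (i, j)
  have hmaps : ∀ j ∈ Finset.Icc (i + 1) (i + μ.row i), φ j ∈ Finset.Icc 1 (μ.row i) := by
    intro j hj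
    rw [Finset.mem_Icc] at hj ⊢
    dsimp only [φ]
    split_ifs with h
    · have := μ.row_lt_row hi hil (j := j) (by omega)
      omega
    · obtain ⟨c, hc, he, -⟩ := μ.exists_hookLength_eq hi hil (j := j) (by omega)
      omega
  have hne : ∀ j k, i < j → j < k → k ≤ i + μ.row i → φ j ≠ φ k := by
    intro j k hij hjk hk
    dsimp only [φ]
    split_ifs with h1 h2 h2
    · have := μ.row_lt_row (i := j) (j := k) (by omega) h1 hjk
      have := μ.row_lt_row hi hil hij
      omega
    · obtain ⟨c, hc, he, hiff⟩ := μ.exists_hookLength_eq hi hil (j := k) (by omega)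
      have := hiff j hij h1
      have := μ.row_lt_row hi hil hij
      omega
    · omega
    · obtain ⟨c, hc, he, hiff⟩ := μ.exists_hookLength_eq hi hil (j := j) (by omega)
      obtain ⟨d, hd, he', hiff'⟩ := μ.exists_hookLength_eq hi hil (j := k) (by omega)
      have hdc : d ≤ c := by
        rcases Nat.eq_zero_or_pos d with h0 | h0
        · omega
        · have h3 := (hiff' (i + d) (by omega) hd).mpr le_rfl
          have h4 := (hiff (i + d) (by omega) hd).mp (by omega)
          omega
      omega
  have hinj : Set.InjOn φ (Finset.Icc (i + 1) (i + μ.row i)) := by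
    intro j hj k hk hjk
    rw [Finset.mem_coe, Finset.mem_Icc] at hj hk
    rcases lt_trichotomy j k with h | h | h
    · exact absurd hjk (hne j k (by omega) h hk.2)
    · exact h
    · exact absurd hjk.symm (hne k j (by omega) h hj.2)
  have himage : (Finset.Icc (i + 1) (i + μ.row i)).image φ = Finset.Icc 1 (μ.row i) := by
    refine Finset.eq_of_subset_of_card_le (Finset.image_subset_iff.mpr hmaps) ?_
    rw [Finset.card_image_of_injOn hinj, Nat.card_Icc, Nat.card_Icc]
    omega
  have hφ : ∏ j ∈ Finset.Icc (i + 1) (i + μ.row i), φ j = (μ.row i).factorial := by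
    rw [← Finset.prod_Ico_id_eq_factorial,
      show Finset.Ico 1 (μ.row i + 1) = Finset.Icc 1 (μ.row i) from rfl, ← himage,
      Finset.prod_image hinj]
  have e1 : ∏ j ∈ Finset.Ioc i μ.length, φ j
      = ∏ k ∈ Finset.Ioc i μ.length, (μ.row i - μ.row k) :=
    Finset.prod_congr rfl fun j hj => if_pos (Finset.mem_Ioc.mp hj).2
  have e2 : ∏ j ∈ Finset.Ioc μ.length (i + μ.row i), φ j
      = ∏ j ∈ Finset.Ioc μ.length (i + μ.row i), μ.hookLength (i, j) :=
    Finset.prod_congr rfl fun j hj => if_neg (not_le.mpr (Finset.mem_Ioc.mp hj).1)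
  have e3 : ∏ j ∈ Finset.Ioc i μ.length, μ.hookLength (i, j)
      = ∏ k ∈ Finset.Ioc i μ.length, (μ.row i + μ.row k) :=
    Finset.prod_congr rfl fun j hj =>
      μ.hookLength_of_le_length hi (Finset.mem_Ioc.mp hj).1 (Finset.mem_Ioc.mp hj).2
  rw [← hφ, hsplit, hsplit, e1, e2, e3]
  ring

theorem hookProd_eq_prod_rows (μ : StrictPartition) :
    μ.hookProd = ∏ i ∈ Finset.Icc 1 μ.length,
      ∏ j ∈ Finset.Icc (i + 1) (i + μ.row i), μ.hookLength (i, j) := by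
  rw [hookProd, boxes, Finset.prod_biUnion]
  · refine Finset.prod_congr rfl fun i _ => ?_
    rw [Finset.prod_product, Finset.prod_singleton]
  · intro i _ j _ hij
    rw [Function.onFun, Finset.disjoint_left]
    rintro ⟨a, b⟩ h1 h2
    simp only [Finset.mem_product, Finset.mem_singleton] at h1 h2
    omega

theorem hookProd_ne_zero (μ : StrictPartition) : (μ.hookProd : ℚ) ≠ 0 := by
  rw [Nat.cast_ne_zero, hookProd, Finset.prod_ne_zero_iff]
  intro b _
  simp only [hookLength]
  omega

theorem hookProd_eq (μ : StrictPartition) : (μ.hookProd : ℚ) = ∏ i ∈ Finset.Icc 1 μ.length,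
    ((μ.row i).factorial
      * ∏ k ∈ Finset.Ioc i μ.length, ((μ.row i : ℚ) + μ.row k) / (μ.row i - μ.row k)) := by
  rw [hookProd_eq_prod_rows, Nat.cast_prod]
  refine Finset.prod_congr rfl fun i hi => ?_
  rw [Finset.mem_Icc] at hi
  have h := congrArg (Nat.cast : ℕ → ℚ) (μ.prod_hookLength_row hi.1 hi.2)
  have hlt : ∀ k ∈ Finset.Ioc i μ.length, μ.row k < μ.row i := fun k hk =>
    μ.row_lt_row hi.1 hi.2 (Finset.mem_Ioc.mp hk).1
  have hsub : ((∏ k ∈ Finset.Ioc i μ.length, (μ.row i - μ.row k) : ℕ) : ℚ)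
      = ∏ k ∈ Finset.Ioc i μ.length, ((μ.row i : ℚ) - μ.row k) := by
    rw [Nat.cast_prod]
    exact Finset.prod_congr rfl fun k hk => Nat.cast_sub (hlt k hk).le
  rw [Nat.cast_mul, Nat.cast_mul, hsub] at h
  rw [Finset.prod_div_distrib, ← mul_div_assoc, eq_div_iff, h, Nat.cast_prod]
  · simp only [Nat.cast_add]
  · rw [Finset.prod_ne_zero_iff]
    intro k hk
    rw [sub_ne_zero]
    exact_mod_cast (hlt k hk).ne'

/-- An additional row of length zero contributes only factors `1`. This lets `μ` and its one-box
extension be compared over the same index set. -/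
theorem hookProd_eq_of_le (μ : StrictPartition) {L : ℕ} (h1 : μ.length ≤ L)
    (h2 : L ≤ μ.length + 1) : (μ.hookProd : ℚ) = ∏ i ∈ Finset.Icc 1 L,
    ((μ.row i).factorial
      * ∏ k ∈ Finset.Ioc i L, ((μ.row i : ℚ) + μ.row k) / (μ.row i - μ.row k)) := by
  rcases h1.eq_or_lt with rfl | h1
  · exact μ.hookProd_eq
  obtain rfl : L = μ.length + 1 := by omega
  rw [Finset.prod_Icc_succ_top (by omega), μ.hookProd_eq, Finset.Ioc_self, Finset.prod_empty,
    μ.row_eq_zero (Nat.lt_succ_self _), Nat.factorial_zero, Nat.cast_one, mul_one, mul_one]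
  refine Finset.prod_congr rfl fun i hi => ?_
  rw [Finset.mem_Icc] at hi
  have hpos : (μ.row i : ℚ) ≠ 0 := by
    exact_mod_cast ((μ.row_pos_iff i).mpr hi).ne'
  rw [Finset.prod_Ioc_succ_top hi.2, μ.row_eq_zero (Nat.lt_succ_self _), Nat.cast_zero, add_zero,
    sub_zero, div_self hpos, mul_one]

/-- Only the factorial of row `i` and the pairs containing `i` change. The pair factor changes sign
when its rows are swapped, before and after the raise, so its ratio has one form for rows above and
below `i`. -/
theorem IsRaise.hookProd_div {μ ν : StrictPartition} {i : ℕ} (h : μ.IsRaise i ν) :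
    (ν.hookProd : ℚ) / μ.hookProd = (μ.row i + 1) *
      ∏ k ∈ (Finset.Icc 1 (μ.length + 1)).erase i,
        (((μ.row i : ℚ) + 1 + μ.row k) / (μ.row i + 1 - μ.row k))
          / (((μ.row i : ℚ) + μ.row k) / (μ.row i - μ.row k)) := by
  have hi : i ∈ Finset.Icc 1 (μ.length + 1) := Finset.mem_Icc.mpr ⟨h.one_le, h.le_length_succ⟩
  rw [ν.hookProd_eq_of_le h.length_le (by have := h.contains.length_le; omega),
    μ.hookProd_eq_of_le (Nat.le_succ _) le_rfl, ← Finset.prod_div_distrib]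
  simp only [mul_div_mul_comm, ← Finset.prod_div_distrib]
  rw [Finset.prod_mul_distrib]
  congr 1
  · rw [Finset.prod_eq_single_of_mem i hi, h.row_self, Nat.factorial_succ, Nat.cast_mul,
      mul_div_cancel_right₀]
    · push_cast; rfl
    · exact_mod_cast Nat.factorial_ne_zero _
    · intro j _ hj
      rw [h.row_of_ne hj, div_self]
      exact_mod_cast Nat.factorial_ne_zero _
  · set σ : ℕ → ℚ := fun k => (((μ.row i : ℚ) + 1 + μ.row k) / (μ.row i + 1 - μ.row k))
          / (((μ.row i : ℚ) + μ.row k) / (μ.row i - μ.row k)) with hσ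
    have hone : ∀ p k, 1 ≤ p → p < k → k ≤ μ.length + 1 → p ≠ i → k ≠ i →
        (((ν.row p : ℚ) + ν.row k) / (ν.row p - ν.row k))
          / (((μ.row p : ℚ) + μ.row k) / (μ.row p - μ.row k)) = 1 := by
      intro p k hp hpk hk hpi hki
      rw [h.row_of_ne hpi, h.row_of_ne hki]
      have hlt : (μ.row k : ℚ) < μ.row p := by
        exact_mod_cast μ.row_lt_row hp (by omega) hpk
      have h0 : (0 : ℚ) ≤ μ.row k := Nat.cast_nonneg _
      exact div_self (div_ne_zero (by linarith) (by linarith))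
    have hself : ∏ k ∈ Finset.Ioc i (μ.length + 1),
        (((ν.row i : ℚ) + ν.row k) / (ν.row i - ν.row k))
          / (((μ.row i : ℚ) + μ.row k) / (μ.row i - μ.row k))
        = ∏ k ∈ Finset.Ioc i (μ.length + 1), σ k := by
      refine Finset.prod_congr rfl fun k hk => ?_
      rw [Finset.mem_Ioc] at hk
      rw [h.row_self, h.row_of_ne (j := k) (by omega), hσ]
      push_cast
      rfl
    have hother : ∀ p ∈ (Finset.Icc 1 (μ.length + 1)).erase i,
        ∏ k ∈ Finset.Ioc p (μ.length + 1),
          (((ν.row p : ℚ) + ν.row k) / (ν.row p - ν.row k))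
            / (((μ.row p : ℚ) + μ.row k) / (μ.row p - μ.row k)) = if p < i then σ p else 1 := by
      intro p hp
      rw [Finset.mem_erase, Finset.mem_Icc] at hp
      rw [Finset.mem_Icc] at hi
      split_ifs with hpi
      · rw [Finset.prod_eq_single_of_mem i (Finset.mem_Ioc.mpr ⟨hpi, hi.2⟩)]
        · rw [h.row_self, h.row_of_ne hp.1, hσ]
          push_cast
          rw [← neg_sub ((μ.row p : ℚ)) (μ.row i + 1), ← neg_sub ((μ.row p : ℚ)) (μ.row i),
            div_neg, div_neg, neg_div_neg_eq, add_comm ((μ.row p : ℚ)),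
            add_comm ((μ.row p : ℚ)) (μ.row i)]
        · intro k hk hki
          rw [Finset.mem_Ioc] at hk
          exact hone p k hp.2.1 hk.1 hk.2 hp.1 hki
      · refine Finset.prod_eq_one fun k hk => ?_
        rw [Finset.mem_Ioc] at hk
        exact hone p k hp.2.1 hk.1 hk.2 hp.1 (by omega)
    rw [← Finset.mul_prod_erase _ _ hi, hself, Finset.prod_congr rfl hother,
      ← Finset.prod_filter, mul_comm,
      ← Finset.prod_filter_mul_prod_filter_not ((Finset.Icc 1 (μ.length + 1)).erase i)
        (fun p => p < i)]
    congr 1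
    refine Finset.prod_congr ?_ fun _ _ => rfl
    ext k
    simp only [Finset.mem_Ioc, Finset.mem_filter, Finset.mem_erase, Finset.mem_Icc] at hi ⊢
    omega

/-! ### One-box weights as interpolation coefficients -/

/-- The node `binom(a + 1, 2)` attached to a row of length `a`. -/
def node (μ : StrictPartition) (i : ℕ) : ℚ := (μ.row i : ℚ) * (μ.row i + 1) / 2

/-- The root `binom(a, 2)` attached to a row of length `a`. -/
def root (μ : StrictPartition) (i : ℕ) : ℚ := (μ.row i : ℚ) * (μ.row i - 1) / 2

theorem node_injOn (μ : StrictPartition) :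
    Set.InjOn μ.node (Finset.Icc 1 (μ.length + 1) : Finset ℕ) := by
  have key : ∀ i j, 1 ≤ i → i < j → j ≤ μ.length + 1 → μ.node i ≠ μ.node j := by
    intro i j hi hij hj
    have hlt : (μ.row j : ℚ) < μ.row i := by
      exact_mod_cast μ.row_lt_row hi (by omega) hij
    have h0 : (0 : ℚ) ≤ μ.row j := Nat.cast_nonneg _
    simp only [node]
    nlinarith
  intro i hi j hj hij
  rw [Finset.mem_coe, Finset.mem_Icc] at hi hj
  rcases lt_trichotomy i j with h | h | h
  · exact absurd hij (key i j hi.1 h hj.2)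
  · exact h
  · exact absurd hij.symm (key j i hj.1 h hi.2)

/-- The factor by which `2^(|μ| - ℓ(μ)) / H_μ` changes from `μ` to `ν`. -/
noncomputable def relWeight (μ ν : StrictPartition) : ℚ :=
  (2 : ℚ) ^ ((ν.size : ℤ) - ν.length - μ.size + μ.length) * (μ.hookProd : ℚ) / (ν.hookProd : ℚ)

theorem relWeight_self (μ : StrictPartition) : μ.relWeight μ = 1 := by
  rw [relWeight, show (μ.size : ℤ) - μ.length - μ.size + μ.length = 0 by ring, zpow_zero, one_mul,
    div_self μ.hookProd_ne_zero]

theorem relWeight_mul (μ κ ν : StrictPartition) :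
    μ.relWeight κ * κ.relWeight ν = μ.relWeight ν := by
  simp only [relWeight]
  rw [show (ν.size : ℤ) - ν.length - μ.size + μ.length
    = (κ.size - κ.length - μ.size + μ.length) + (ν.size - ν.length - κ.size + κ.length) by ring,
    zpow_add₀ two_ne_zero (κ.size - κ.length - μ.size + μ.length : ℤ)]
  generalize (2 : ℚ) ^ (κ.size - κ.length - μ.size + μ.length : ℤ) = a
  generalize (2 : ℚ) ^ (ν.size - ν.length - κ.size + κ.length : ℤ) = b
  have := κ.hookProd_ne_zero
  have := ν.hookProd_ne_zero
  field_simp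

/-- With `a = μ_i` and `b = μ_k`, the differences `X_i - X_k` and `X_i - Y_k` factor as
`(a+1+b)(a-b)/2` and `(a+1-b)(a+b)/2`, which are the pieces of the hook ratio. -/
theorem IsRaise.relWeight_eq {μ ν : StrictPartition} {i : ℕ} (h : μ.IsRaise i ν) :
    μ.relWeight ν = (∏ j ∈ Finset.Icc 1 μ.length, (μ.node i - μ.root j))
      / ∏ j ∈ (Finset.Icc 1 (μ.length + 1)).erase i, (μ.node i - μ.node j) := by
  have hfac : ∀ k : ℕ, (((μ.row i : ℚ) + 1 + μ.row k) / (μ.row i + 1 - μ.row k))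
          / (((μ.row i : ℚ) + μ.row k) / (μ.row i - μ.row k))
        = (μ.node i - μ.node k) / (μ.node i - μ.root k) := by
    intro k
    rw [div_div_div_eq, node, node, root,
      show (μ.row i : ℚ) * (μ.row i + 1) / 2 - μ.row k * (μ.row k + 1) / 2
        = 2⁻¹ * ((μ.row i + 1 + μ.row k) * (μ.row i - μ.row k)) by ring,
      show (μ.row i : ℚ) * (μ.row i + 1) / 2 - μ.row k * (μ.row k - 1) / 2
        = 2⁻¹ * ((μ.row i + 1 - μ.row k) * (μ.row i + μ.row k)) by ring,
      mul_div_mul_left _ _ (by norm_num)]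
  have hratio : (μ.hookProd : ℚ) / ν.hookProd = (μ.row i + 1 : ℚ)⁻¹
      * ((∏ k ∈ (Finset.Icc 1 (μ.length + 1)).erase i, (μ.node i - μ.root k))
        / ∏ k ∈ (Finset.Icc 1 (μ.length + 1)).erase i, (μ.node i - μ.node k)) := by
    rw [← inv_div, h.hookProd_div, Finset.prod_congr rfl fun k _ => hfac k,
      Finset.prod_div_distrib, mul_inv, inv_div]
  have hroot : μ.root (μ.length + 1) = 0 := by
    rw [root, μ.row_eq_zero (Nat.lt_succ_self _)]
    simp
  rw [relWeight, mul_div_assoc, hratio]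
  rcases h.le_length_succ.lt_or_eq with hi | hi
  · have hi' : i ≤ μ.length := by omega
    have hmem : i ∈ Finset.Icc 1 μ.length := Finset.mem_Icc.mpr ⟨h.one_le, hi'⟩
    have herase : (Finset.Icc 1 (μ.length + 1)).erase i
        = insert (μ.length + 1) ((Finset.Icc 1 μ.length).erase i) := by
      ext k
      simp only [Finset.mem_erase, Finset.mem_insert, Finset.mem_Icc]
      have := h.one_le
      omega
    have hpos : (μ.row i : ℚ) ≠ 0 := by
      exact_mod_cast ((μ.row_pos_iff i).mpr ⟨h.one_le, hi'⟩).ne'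
    have hprod : ∏ k ∈ (Finset.Icc 1 (μ.length + 1)).erase i, (μ.node i - μ.root k)
        = μ.node i * ∏ k ∈ (Finset.Icc 1 μ.length).erase i, (μ.node i - μ.root k) := by
      rw [herase, Finset.prod_insert (by simp), hroot, sub_zero]
    -- The length is unchanged, so the power of two is `2`. It combines with `1/(a+1)` and the
    -- factor `X_i` from the empty row into `a = X_i - Y_i`, the missing factor at `j = i`.
    rw [h.length_eq_of_le hi', h.size_eq, hprod, ← Finset.mul_prod_erase _ _ hmem,
      show (((μ.size + 1 : ℕ) : ℤ) - μ.length - μ.size + μ.length) = 1 by push_cast; ring,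
      zpow_one, ← mul_div_assoc, ← mul_div_assoc]
    congr 1
    rw [← mul_assoc, ← mul_assoc]
    congr 1
    have : (μ.row i + 1 : ℚ) ≠ 0 := by positivity
    simp only [node, root]
    field_simp
    ring
  · have herase : (Finset.Icc 1 (μ.length + 1)).erase i = Finset.Icc 1 μ.length := by
      ext k
      simp only [Finset.mem_erase, Finset.mem_Icc]
      omega
    -- A new row raises size and length together, so the power of two is `1`; also `a = 0`.
    rw [h.length_eq_of_eq hi, h.size_eq, herase, μ.row_eq_zero (i := i) (by omega),
      show (((μ.size + 1 : ℕ) : ℤ) - ((μ.length + 1 : ℕ) : ℤ) - μ.size + μ.length) = 0 by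
        push_cast; ring]
    simp

theorem sum_relWeight_mul (μ : StrictPartition) (G : StrictPartition → ℚ) (g : ℚ → ℚ)
    (hG : ∀ i ν, μ.IsRaise i ν → G ν = g (μ.node i)) :
    ∑ ν ∈ μ.extensions 1, μ.relWeight ν * G ν
      = dividedDiff (Finset.Icc 1 (μ.length + 1)) μ.node
        (fun z => g z * ∏ j ∈ Finset.Icc 1 μ.length, (z - μ.root j)) := by
  choose! e he using fun ν => exists_isRaise_of_mem_extensions (μ := μ) (ν := ν)
  rw [dividedDiff]
  refine Finset.sum_of_injOn e ?_ ?_ ?_ ?_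
  · intro ν hν ν' hν' h
    have h1 := he ν hν
    have h2 := he ν' hν'
    rw [h] at h1
    exact ext_row fun j => congrFun (h1.trans h2.symm) j
  · intro ν hν
    exact Finset.mem_coe.mpr (Finset.mem_Icc.mpr ⟨(he ν hν).one_le, (he ν hν).le_length_succ⟩)
  · intro i hi hne
    rw [Finset.mem_Icc] at hi
    by_cases hr : ∃ ν, μ.IsRaise i ν
    · obtain ⟨ν, hν⟩ := hr
      refine absurd ⟨ν, hν.mem_extensions, ?_⟩ hne
      by_contra hc
      have h1 := (he ν hν.mem_extensions).row_self
      rw [hν.row_of_ne hc] at h1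
      omega
    -- No box fits in row `i`, so row `i - 1` is exactly one longer. Its root is then the node of
    -- row `i`, and the corresponding term is zero.
    · have hc := mt (μ.exists_isRaise hi.1 hi.2) hr
      push Not at hc
      have hlt := μ.row_lt_row (i := i - 1) (j := i) (by omega) (by omega) (by omega)
      have hrow : μ.row (i - 1) = μ.row i + 1 := by omega
      rw [Finset.prod_eq_zero (i := i - 1) (Finset.mem_Icc.mpr (by omega)), mul_zero, zero_div]
      rw [node, root, hrow]
      push_cast
      ring
  · intro ν hν
    rw [hG _ ν (he ν hν), (he ν hν).relWeight_eq]
    ring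

end StrictPartition

/-! ### Counting increasing labelings -/

section Labelings

variable {α : Type*} [DecidableEq α]

/-- The bijective labelings of `A` by `1, …, N` that are increasing along `R`, extended by `0`. -/
def increasingLabelings (R : α → α → Prop) (A : Finset α) (N : ℕ) : Set (α → ℕ) :=
  {f | (∀ x, x ∉ A → f x = 0) ∧ Set.BijOn f A (Set.Icc 1 N) ∧
    ∀ a ∈ A, ∀ b ∈ A, R a b → f a < f b}

theorem increasingLabelings_finite (R : α → α → Prop) (A : Finset α) (N : ℕ) :
    (increasingLabelings R A N).Finite := by
  rw [Set.finite_coe_iff.symm]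
  let F : increasingLabelings R A N → A → Fin (N + 1) := fun f a =>
    ⟨f.1 a, Nat.lt_succ_of_le (f.2.2.1.mapsTo a.2).2⟩
  refine Finite.of_injective F fun f g h => Subtype.ext (funext fun x => ?_)
  by_cases hx : x ∈ A
  · exact congrArg Fin.val (congrFun h ⟨x, hx⟩)
  · rw [f.2.1 x hx, g.2.1 x hx]

/-- The number of increasing labelings of `A`. -/
noncomputable def numLabelings (R : α → α → Prop) (A : Finset α) : ℕ :=
  Nat.card (increasingLabelings R A A.card)

open Classical in
-- The largest label sits on an element with no `R`-successor in `A`; deleting it leaves an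
-- increasing labeling of the rest, and conversely. Extension by `0` keeps all labelings in the one
-- type `α → ℕ`, so both directions are a `Function.update`.
theorem numLabelings_eq_sum (R : α → α → Prop) {A : Finset α} (hA : A.Nonempty) :
    numLabelings R A = ∑ b ∈ A.filter (fun b => ∀ a ∈ A, ¬ R b a), numLabelings R (A.erase b) := by
  have hcard : ∀ b ∈ A, A.card = (A.erase b).card + 1 := fun b hb =>
    (Finset.card_erase_add_one hb).symm
  have hN : ∀ (B : Finset α), numLabelings R B
      = (increasingLabelings_finite R B B.card).toFinset.card := fun B =>
    Nat.card_eq_card_finite_toFinset _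
  simp only [hN]
  rw [← Finset.card_sigma]
  symm
  refine Finset.card_bij (fun p _ => Function.update p.2 p.1 A.card) ?_ ?_ ?_
  · rintro ⟨b, f⟩ hp
    simp only [Finset.mem_sigma, Finset.mem_filter, Set.Finite.mem_toFinset] at hp ⊢
    obtain ⟨⟨hb, hmax⟩, h0, hbij, hinc⟩ := hp
    have hc := hcard b hb
    have hle : ∀ a ∈ A, a ≠ b → 1 ≤ f a ∧ f a < A.card := fun a ha hab => by
      have := hbij.mapsTo (Finset.mem_coe.mpr (Finset.mem_erase.mpr ⟨hab, ha⟩))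
      rw [Set.mem_Icc] at this
      omega
    refine ⟨fun x hx => ?_, ⟨?_, ?_, ?_⟩, ?_⟩
    · rw [Function.update_of_ne (fun h : x = b => hx (h.symm ▸ hb))]
      exact h0 x fun h => hx (Finset.mem_of_mem_erase h)
    · intro a ha
      by_cases hab : a = b
      · subst hab
        rw [Function.update_self, Set.mem_Icc]
        omega
      · rw [Function.update_of_ne hab, Set.mem_Icc]
        have := hle a ha hab
        omega
    · intro a ha a' ha' h
      by_cases hab : a = b <;> by_cases hab' : a' = b
      · rw [hab, hab']
      · subst hab
        rw [Function.update_self, Function.update_of_ne hab'] at h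
        have := hle a' ha' hab'
        omega
      · subst hab'
        rw [Function.update_self, Function.update_of_ne hab] at h
        have := hle a ha hab
        omega
      · rw [Function.update_of_ne hab, Function.update_of_ne hab'] at h
        exact hbij.injOn (Finset.mem_erase.mpr ⟨hab, ha⟩) (Finset.mem_erase.mpr ⟨hab', ha'⟩) h
    · intro k hk
      rw [Set.mem_Icc] at hk
      by_cases hk' : k = A.card
      · exact ⟨b, hb, by rw [Function.update_self, hk']⟩
      · obtain ⟨a, ha, rfl⟩ := hbij.surjOn (Set.mem_Icc.mpr (by omega : 1 ≤ k ∧ k ≤ _))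
        rw [Finset.mem_coe, Finset.mem_erase] at ha
        exact ⟨a, ha.2, Function.update_of_ne ha.1 _ _⟩
    · intro a ha a' ha' hR
      have hab : a ≠ b := fun h => hmax a' ha' (h ▸ hR)
      rw [Function.update_of_ne hab]
      by_cases hab' : a' = b
      · rw [hab', Function.update_self]
        exact (hle a ha hab).2
      · rw [Function.update_of_ne hab']
        exact hinc a (Finset.mem_erase.mpr ⟨hab, ha⟩) a' (Finset.mem_erase.mpr ⟨hab', ha'⟩) hR
  · rintro ⟨b, f⟩ hp ⟨b', f'⟩ hp' h
    simp only [Finset.mem_sigma, Finset.mem_filter, Set.Finite.mem_toFinset] at hp hp' h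
    obtain ⟨⟨hb, -⟩, h0, hbij, -⟩ := hp
    obtain ⟨⟨hb', -⟩, h0', hbij', -⟩ := hp'
    have hbb : b = b' := by
      by_contra hne
      have h1 := congrFun h b
      rw [Function.update_self, Function.update_of_ne hne] at h1
      have := hbij'.mapsTo (Finset.mem_coe.mpr (Finset.mem_erase.mpr ⟨hne, hb⟩))
      rw [Set.mem_Icc] at this
      have := hcard b' hb'
      omega
    subst hbb
    have hff : f = f' := by
      funext x
      by_cases hx : x = b
      · rw [hx, h0 b (Finset.notMem_erase _ _), h0' b (Finset.notMem_erase _ _)]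
      · have := congrFun h x
        rwa [Function.update_of_ne hx, Function.update_of_ne hx] at this
    rw [hff]
  · intro g hg
    rw [Set.Finite.mem_toFinset] at hg
    obtain ⟨h0, hbij, hinc⟩ := hg
    have hpos := Finset.card_pos.mpr hA
    obtain ⟨b, hb, hgb⟩ := hbij.surjOn (Set.mem_Icc.mpr (by omega : 1 ≤ A.card ∧ A.card ≤ _))
    rw [Finset.mem_coe] at hb
    have hc := hcard b hb
    have hlt : ∀ a ∈ A, a ≠ b → 1 ≤ g a ∧ g a < A.card := fun a ha hab => by
      have h1 := hbij.mapsTo ha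
      have h2 : g a ≠ g b := fun h => hab (hbij.injOn ha hb h)
      rw [Set.mem_Icc] at h1
      omega
    refine ⟨⟨b, Function.update g b 0⟩, ?_, ?_⟩
    · simp only [Finset.mem_sigma, Finset.mem_filter, Set.Finite.mem_toFinset]
      have hmax : ∀ a ∈ A, ¬ R b a := fun a ha hR => by
        have h1 := hinc b hb a ha hR
        have h2 := hbij.mapsTo ha
        rw [Set.mem_Icc] at h2
        omega
      refine ⟨⟨hb, hmax⟩, fun x hx => ?_, ⟨?_, ?_, ?_⟩, ?_⟩
      · by_cases hxb : x = b
        · rw [hxb, Function.update_self]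
        · rw [Function.update_of_ne hxb]
          exact h0 x fun h => hx (Finset.mem_erase.mpr ⟨hxb, h⟩)
      · intro a ha
        rw [Finset.mem_coe, Finset.mem_erase] at ha
        rw [Function.update_of_ne ha.1, Set.mem_Icc]
        have := hlt a ha.2 ha.1
        omega
      · intro a ha a' ha' h
        rw [Finset.mem_coe, Finset.mem_erase] at ha ha'
        rw [Function.update_of_ne ha.1, Function.update_of_ne ha'.1] at h
        exact hbij.injOn ha.2 ha'.2 h
      · intro k hk
        rw [Set.mem_Icc] at hk
        obtain ⟨a, ha, rfl⟩ := hbij.surjOn (Set.mem_Icc.mpr (by omega : 1 ≤ k ∧ k ≤ A.card))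
        have hab : a ≠ b := by
          rintro rfl
          omega
        exact ⟨a, Finset.mem_erase.mpr ⟨hab, ha⟩, Function.update_of_ne hab _ _⟩
      · intro a ha a' ha' hR
        rw [Finset.mem_erase] at ha ha'
        rw [Function.update_of_ne ha.1, Function.update_of_ne ha'.1]
        exact hinc a ha.2 a' ha'.2 hR
    · dsimp only
      rw [Function.update_idem, ← hgb, Function.update_eq_self]

end Labelings

/-! ### Standard tableaux and their recursion -/

namespace StrictPartition

/-- The box `b` lies in the row of `a` to the right of it, or in its column below it. -/
def Precedes (a b : ℕ × ℕ) : Prop := a.1 = b.1 ∧ a.2 < b.2 ∨ a.2 = b.2 ∧ a.1 < b.1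

theorem numTableaux_eq_numLabelings (ν μ : StrictPartition) :
    ν.numTableaux μ = numLabelings Precedes (ν.skewBoxes μ) := by
  let F : ν.SkewTableau μ → increasingLabelings Precedes (ν.skewBoxes μ) (ν.skewBoxes μ).card :=
    fun T => ⟨fun x => if h : x ∈ ν.skewBoxes μ then (T.1 ⟨x, h⟩ : ℕ) + 1 else 0, by
      refine ⟨fun x hx => dif_neg hx, ⟨?_, ?_, ?_⟩, ?_⟩
      · intro a ha
        rw [Finset.mem_coe] at ha
        simp only [dif_pos ha, Set.mem_Icc]
        have := (T.1 ⟨a, ha⟩).isLt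
        omega
      · intro a ha b hb h
        rw [Finset.mem_coe] at ha hb
        simp only [dif_pos ha, dif_pos hb] at h
        exact congrArg Subtype.val (T.1.injective (Fin.ext (by omega) : T.1 ⟨a, ha⟩ = T.1 ⟨b, hb⟩))
      · intro k hk
        rw [Set.mem_Icc] at hk
        refine ⟨T.1.symm ⟨k - 1, by omega⟩, (T.1.symm _).2, ?_⟩
        simp only [Subtype.coe_eta, Finset.coe_mem, dite_true, Equiv.apply_symm_apply]
        omega
      · intro a ha b hb h
        simp only [dif_pos ha, dif_pos hb, add_lt_add_iff_right, Fin.val_fin_lt]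
        rcases h with h | h
        · exact T.2.1 ⟨a, ha⟩ ⟨b, hb⟩ h.1 h.2
        · exact T.2.2 ⟨a, ha⟩ ⟨b, hb⟩ h.1 h.2⟩
  refine Nat.card_congr (Equiv.ofBijective F ⟨?_, ?_⟩)
  · intro T T' h
    refine Subtype.ext (Equiv.ext fun a => Fin.ext ?_)
    have := congrFun (congrArg Subtype.val h) a.1
    simpa only [F, dif_pos a.2, add_left_inj] using this
  · rintro ⟨f, h0, hbij, hinc⟩
    have hm : ∀ a : ν.skewBoxes μ, 1 ≤ f a ∧ f a ≤ (ν.skewBoxes μ).card := fun a =>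
      hbij.mapsTo a.2
    let e : ν.skewBoxes μ → Fin (ν.skewBoxes μ).card := fun a =>
      ⟨f a - 1, by have := hm a; omega⟩
    have he : Function.Bijective e := by
      constructor
      · intro a b h
        have h1 := hm a
        have h2 := hm b
        have h3 : f a - 1 = f b - 1 := congrArg Fin.val h
        exact Subtype.ext (hbij.injOn a.2 b.2 (by omega))
      · intro k
        obtain ⟨a, ha, hk⟩ := hbij.surjOn (Set.mem_Icc.mpr (by omega :
          1 ≤ (k : ℕ) + 1 ∧ (k : ℕ) + 1 ≤ (ν.skewBoxes μ).card))
        exact ⟨⟨a, ha⟩, Fin.ext (by dsimp only [e]; omega)⟩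
    have hlt : ∀ a b : ν.skewBoxes μ, Precedes a b → e a < e b := fun a b h => by
      have h1 := hm a
      have h2 := hinc a a.2 b b.2 h
      rw [Fin.lt_def]
      dsimp only [e]
      omega
    refine ⟨⟨Equiv.ofBijective e he, fun a b h h' => hlt a b (Or.inl ⟨h, h'⟩),
      fun a b h h' => hlt a b (Or.inr ⟨h, h'⟩)⟩, Subtype.ext (funext fun x => ?_)⟩
    by_cases hx : x ∈ ν.skewBoxes μ
    · have : 1 ≤ f x ∧ f x ≤ (ν.skewBoxes μ).card := hm ⟨x, hx⟩
      simp only [F, dif_pos hx, Equiv.ofBijective_apply, e]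
      omega
    · simp only [F, dif_neg hx, h0 x hx]

theorem Contains.boxes_subset {μ ν : StrictPartition} (h : ν.Contains μ) :
    μ.boxes ⊆ ν.boxes := by
  intro b hb
  rw [mem_boxes] at hb ⊢
  have := h b.1
  omega

theorem skewBoxes_nonempty {μ ν : StrictPartition} {n : ℕ} (h : ν ∈ μ.extensions (n + 1)) :
    (ν.skewBoxes μ).Nonempty := by
  obtain ⟨hc, hs⟩ := (mem_extensions _ _ _).mp h
  obtain ⟨i, -, hi⟩ : ∃ i ∈ Finset.Icc 1 ν.length, μ.row i < ν.row i := by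
    refine Finset.exists_lt_of_sum_lt ?_
    rw [← ν.size_eq_sum_row le_rfl, ← μ.size_eq_sum_row hc.length_le]
    omega
  refine ⟨(i, i + ν.row i), ?_⟩
  rw [skewBoxes, Finset.mem_sdiff, mem_boxes, mem_boxes]
  dsimp only
  omega

theorem IsRaise.not_precedes {κ ν : StrictPartition} {i : ℕ} (h : κ.IsRaise i ν) {a : ℕ × ℕ}
    (ha : a ∈ ν.boxes) : ¬ Precedes (i, i + κ.row i + 1) a := by
  obtain ⟨j, k⟩ := a
  rw [mem_boxes] at ha
  simp only [Precedes] at ha ⊢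
  rintro (⟨rfl, h'⟩ | ⟨rfl, h'⟩)
  · rw [h.row_self] at ha
    omega
  · rw [h.row_of_ne (by omega)] at ha
    have := κ.row_add_le (j := j) h.one_le h'.le ((κ.row_pos_iff j).mp (by omega)).2
    omega

open Classical in
-- The boxes of `ν/μ` that can carry the largest entry are exactly those whose removal leaves a
-- strict partition containing `μ`.
theorem numTableaux_eq_sum {μ ν : StrictPartition} {n : ℕ} (h : ν ∈ μ.extensions (n + 1)) :
    ν.numTableaux μ
      = ∑ κ ∈ (μ.extensions n).filter (fun κ => ν ∈ κ.extensions 1), κ.numTableaux μ := by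
  simp only [numTableaux_eq_numLabelings]
  rw [numLabelings_eq_sum _ (skewBoxes_nonempty h)]
  symm
  choose! e he using fun κ => exists_isRaise_of_mem_extensions (μ := κ) (ν := ν)
  obtain ⟨hνμ, hsize⟩ := (mem_extensions _ _ _).mp h
  refine Finset.sum_nbij (fun κ => (e κ, e κ + κ.row (e κ) + 1)) ?_ ?_ ?_ ?_
  · intro κ hκ
    rw [Finset.mem_filter, mem_extensions] at hκ
    have hr := he κ hκ.2
    rw [Finset.mem_filter, skewBoxes, Finset.mem_sdiff, hr.boxes_eq]
    refine ⟨⟨Finset.mem_insert_self _ _, fun hb =>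
      IsRaise.notMem_boxes κ (e κ) (hκ.1.1.boxes_subset hb)⟩, fun a ha => hr.not_precedes ?_⟩
    rw [hr.boxes_eq]
    exact (Finset.mem_sdiff.mp ha).1
  · intro κ hκ κ' hκ' hee
    rw [Finset.mem_coe, Finset.mem_filter] at hκ hκ'
    have h1 := he κ hκ.2
    have h2 := he κ' hκ'.2
    rw [Prod.mk.injEq] at hee
    rw [← hee.1] at h2
    refine ext_row fun j => ?_
    by_cases hj : j = e κ
    · have h3 := h1.row_self
      have h4 := h2.row_self
      rw [hj]
      omega
    · rw [← h1.row_of_ne hj, h2.row_of_ne hj]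
  · rintro ⟨i, j⟩ hb
    rw [Finset.mem_coe, Finset.mem_filter, skewBoxes, Finset.mem_sdiff, mem_boxes,
      mem_boxes] at hb
    obtain ⟨⟨hbν, hbμ⟩, hmax⟩ := hb
    dsimp only at hbν hbμ
    have hi := (ν.row_pos_iff i).mp (by omega)
    have hj : j = i + ν.row i := by
      by_contra hne
      refine hmax (i, j + 1) ?_ (Or.inl ⟨rfl, Nat.lt_succ_self j⟩)
      rw [Finset.mem_sdiff, mem_boxes, mem_boxes]
      dsimp only
      omega
    -- Otherwise row `i + 1` of `ν` ends in the same column `j`, and the box `(i + 1, j)`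
    -- contradicts maximality. It lies outside `μ`, since otherwise `μ` would contain `(i, j)` too.
    have hlow : ν.row i = 1 ∨ ν.row (i + 1) + 1 < ν.row i := by
      by_contra hne
      have h1 := ν.row_lt_row hi.1 hi.2 (lt_add_one i)
      refine hmax (i + 1, j) ?_ (Or.inr ⟨rfl, Nat.lt_succ_self i⟩)
      rw [Finset.mem_sdiff, mem_boxes, mem_boxes]
      dsimp only
      refine ⟨by omega, fun hc => ?_⟩
      have h2 := (μ.row_pos_iff (i + 1)).mp (by omega)
      have h3 := μ.row_lt_row hi.1 (by omega) (lt_add_one i)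
      omega
    obtain ⟨κ, hκ⟩ := ν.exists_isRaise_of_lower (by omega) hlow
    have hκμ : κ.Contains μ := by
      intro k
      by_cases hk : k = i
      · have := hκ.row_self
        rw [hk]
        omega
      · rw [← hκ.row_of_ne hk]
        exact hνμ k
    have hmem : κ ∈ (μ.extensions n).filter (fun κ => ν ∈ κ.extensions 1) := by
      rw [Finset.mem_filter, mem_extensions]
      have := hκ.size_eq
      exact ⟨⟨hκμ, by omega⟩, hκ.mem_extensions⟩
    refine ⟨κ, hmem, ?_⟩
    have hei : e κ = i := by
      by_contra hc
      have h1 := (he κ hκ.mem_extensions).row_self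
      rw [hκ.row_of_ne hc] at h1
      omega
    have := hκ.row_self
    simp only [hei, Prod.mk.injEq, true_and]
    omega
  · intro κ hκ
    rw [Finset.mem_filter, mem_extensions] at hκ
    have hr := he κ hκ.2
    congr 1
    rw [skewBoxes, skewBoxes, hr.boxes_eq]
    ext b
    simp only [Finset.mem_sdiff, Finset.mem_erase, Finset.mem_insert]
    have hn := IsRaise.notMem_boxes κ (e κ)
    constructor
    · rintro ⟨h1, h2⟩
      exact ⟨fun h => hn (h ▸ h1), Or.inr h1, h2⟩
    · rintro ⟨h1, h2 | h2, h3⟩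
      · exact absurd h2 h1
      · exact ⟨h2, h3⟩

theorem sum_extensions_succ (μ : StrictPartition) (n : ℕ) (F : StrictPartition → ℚ) :
    ∑ ν ∈ μ.extensions (n + 1), (ν.numTableaux μ : ℚ) * F ν
      = ∑ κ ∈ μ.extensions n, (κ.numTableaux μ : ℚ) * ∑ ν ∈ κ.extensions 1, F ν := by
  classical
  rw [Finset.sum_congr rfl fun ν hν => by
    rw [numTableaux_eq_sum hν, Nat.cast_sum, Finset.sum_mul]]
  simp only [Finset.mul_sum]
  refine Finset.sum_comm' fun ν κ => ?_
  simp only [Finset.mem_filter, mem_extensions]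
  constructor
  · tauto
  · rintro ⟨⟨h3, h4⟩, h1, h2⟩
    exact ⟨⟨fun i => (h1 i).trans (h3 i), by omega⟩, ⟨h1, h2⟩, h3, h4⟩

theorem extensions_zero (μ : StrictPartition) : μ.extensions 0 = {μ} := by
  ext ν
  rw [mem_extensions, Finset.mem_singleton]
  constructor
  · rintro ⟨hc, hs⟩
    rw [add_zero, ν.size_eq_sum_row le_rfl, μ.size_eq_sum_row hc.length_le] at hs
    have := (Finset.sum_eq_sum_iff_of_le fun i _ => hc i).mp hs.symm
    refine ext_row fun i => ?_
    by_cases hi : 1 ≤ i ∧ i ≤ ν.length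
    · exact (this i (Finset.mem_Icc.mpr hi)).symm
    · have h1 := (ν.row_pos_iff i).not.mpr hi
      have h2 := hc i
      omega
  · rintro rfl
    exact ⟨fun _ => le_rfl, rfl⟩

theorem numTableaux_self (μ : StrictPartition) : μ.numTableaux μ = 1 := by
  rw [numTableaux_eq_numLabelings, skewBoxes, Finset.sdiff_self, numLabelings,
    Nat.card_eq_one_iff_exists]
  refine ⟨⟨fun _ => 0, by simp [increasingLabelings]⟩, ?_⟩
  rintro ⟨f, h0, -⟩
  exact Subtype.ext (funext fun x => h0 x (Finset.notMem_empty x))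

/-! ### Corners and the numbers `q_k` -/

/-- The rows whose last box is an outer corner. -/
def cornerRows (μ : StrictPartition) : Finset ℕ :=
  (Finset.Icc 1 μ.length).filter fun i => μ.row i = 1 ∨ μ.row (i + 1) + 1 < μ.row i

theorem mem_cornerRows (μ : StrictPartition) (i : ℕ) : i ∈ μ.cornerRows ↔
    (1 ≤ i ∧ i ≤ μ.length) ∧ (μ.row i = 1 ∨ μ.row (i + 1) + 1 < μ.row i) := by
  rw [cornerRows, Finset.mem_filter, Finset.mem_Icc]

theorem outerCorners_eq_image (μ : StrictPartition) :
    μ.outerCorners = μ.cornerRows.image fun i => (i, i + μ.row i) := by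
  ext ⟨i, j⟩
  simp only [outerCorners, Finset.mem_filter, Finset.mem_image, Prod.mk.injEq, mem_cornerRows]
  constructor
  · rintro ⟨hb, ν, hν⟩
    rw [mem_boxes] at hb
    dsimp only at hb
    have hi := (μ.row_pos_iff i).mp (by omega)
    have hmem : ∀ b, b ∈ ν.boxes ↔ b ≠ (i, j) ∧ b ∈ μ.boxes := fun b => by
      rw [hν, Finset.mem_erase]
    have hnot : ¬ j ≤ i + ν.row i := fun h =>
      ((hmem (i, j)).mp ((ν.mem_boxes (i, j)).mpr ⟨hb.1, h⟩)).1 rfl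
    have hj : j = i + μ.row i := by
      by_contra hne
      have h1 := (hmem (i, j + 1)).mpr ⟨by simp, (μ.mem_boxes _).mpr (by dsimp only; omega)⟩
      rw [mem_boxes] at h1
      dsimp only at h1
      omega
    refine ⟨i, ⟨hi, ?_⟩, rfl, hj.symm⟩
    by_contra hne
    have h1 := μ.row_lt_row hi.1 hi.2 (lt_add_one i)
    have h2 := (hmem (i + 1, j)).mpr ⟨by simp, (μ.mem_boxes _).mpr (by dsimp only; omega)⟩
    rw [mem_boxes] at h2
    dsimp only at h2
    have h3 := ν.row_succ_lt_or hi.1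
    omega
  · rintro ⟨i, ⟨hi, h⟩, rfl, rfl⟩
    have h0 := (μ.row_pos_iff i).mpr hi
    obtain ⟨κ, hκ⟩ := μ.exists_isRaise_of_lower h0 h
    refine ⟨(μ.mem_boxes _).mpr (by dsimp only; omega), κ, ?_⟩
    rw [hκ.boxes_eq, hκ.row_self, ← add_assoc,
      Finset.erase_insert (IsRaise.notMem_boxes κ i)]

theorem length_mem_cornerRows (μ : StrictPartition) (h : 1 ≤ μ.length) :
    μ.length ∈ μ.cornerRows := by
  have h1 := (μ.row_pos_iff μ.length).mpr ⟨h, le_rfl⟩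
  have h2 := μ.row_eq_zero (lt_add_one μ.length)
  rw [mem_cornerRows]
  omega

theorem row_eq_of_notMem_cornerRows (μ : StrictPartition) {i : ℕ} (hi : 1 ≤ i)
    (hl : i ≤ μ.length) (h : i ∉ μ.cornerRows) :
    μ.row i = μ.row (i + 1) + 1 ∧ i + 1 ≤ μ.length := by
  rw [mem_cornerRows] at h
  have h1 := (μ.row_pos_iff i).mpr ⟨hi, hl⟩
  have h2 := μ.row_lt_row hi hl (lt_add_one i)
  have h3 := μ.row_pos_iff (i + 1)
  omega

/-- The largest row below `m` that ends in an outer corner, or `0`. -/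
def lastCornerRow (μ : StrictPartition) (m : ℕ) : ℕ :=
  (μ.cornerRows.filter fun i => i < m).sup id

theorem lastCornerRow_one (μ : StrictPartition) : μ.lastCornerRow 1 = 0 := by
  rw [lastCornerRow, Finset.filter_eq_empty_iff.mpr, Finset.sup_empty]
  · rfl
  · intro i hi
    rw [mem_cornerRows] at hi
    omega

theorem lastCornerRow_succ_of_mem (μ : StrictPartition) {m : ℕ} (h : m ∈ μ.cornerRows) :
    μ.lastCornerRow (m + 1) = m := by
  apply le_antisymm
  · refine Finset.sup_le fun i hi => ?_
    have := (Finset.mem_filter.mp hi).2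
    exact Nat.lt_succ_iff.mp this
  · exact Finset.le_sup (f := id) (Finset.mem_filter.mpr ⟨h, lt_add_one m⟩)

theorem lastCornerRow_succ_of_notMem (μ : StrictPartition) {m : ℕ} (h : m ∉ μ.cornerRows) :
    μ.lastCornerRow (m + 1) = μ.lastCornerRow m := by
  rw [lastCornerRow, lastCornerRow]
  congr 1
  refine Finset.filter_congr fun i hi => ?_
  have : i ≠ m := fun hc => h (hc ▸ hi)
  omega

theorem lastCornerRow_lt (μ : StrictPartition) {m : ℕ} (h : 1 ≤ m) : μ.lastCornerRow m < m := by
  rw [lastCornerRow, Finset.sup_lt_iff (by rw [Nat.bot_eq_zero]; omega)]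
  exact fun i hi => (Finset.mem_filter.mp hi).2

theorem sup_cornerRows (μ : StrictPartition) : μ.cornerRows.sup id = μ.length := by
  apply le_antisymm
  · exact Finset.sup_le fun i hi => ((μ.mem_cornerRows i).mp hi).1.2
  · rcases Nat.eq_zero_or_pos μ.length with h | h
    · omega
    · exact Finset.le_sup (f := id) (μ.length_mem_cornerRows h)

/-- Between consecutive corner rows the parts drop by exactly one, so all rows of such a run end in
the same column. -/
theorem lastCornerRow_add_row (μ : StrictPartition) {m : ℕ} (hm : 1 ≤ m) (hl : m ≤ μ.length) :
    μ.lastCornerRow m + 1 + μ.row (μ.lastCornerRow m + 1) = m + μ.row m := by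
  induction m, hm using Nat.le_induction with
  | base => rw [lastCornerRow_one]
  | succ m hm ih =>
    by_cases h : m ∈ μ.cornerRows
    · rw [μ.lastCornerRow_succ_of_mem h]
    · rw [μ.lastCornerRow_succ_of_notMem h, ih (by omega),
        (μ.row_eq_of_notMem_cornerRows hm (by omega) h).1]
      omega

theorem outerColumn_strictAnti (μ : StrictPartition) {i j : ℕ} (hi : i ∈ μ.cornerRows)
    (hj : j ∈ μ.cornerRows) (hij : i < j) : j + μ.row j < i + μ.row i := by
  rw [mem_cornerRows] at hi hj
  have h1 := μ.row_lt_row hi.1.1 hi.1.2 hij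
  have h2 := (μ.row_pos_iff j).mpr hj.1
  have h3 := μ.row_add_le (i := i + 1) (j := j) (by omega) hij hj.1.2
  omega

theorem outerColumn_injOn (μ : StrictPartition) :
    Set.InjOn (fun i => i + μ.row i) μ.cornerRows := by
  intro i hi j hj h
  rcases lt_trichotomy i j with hij | hij | hij
  · exact absurd h (μ.outerColumn_strictAnti hi hj hij).ne'
  · exact hij
  · exact absurd h (μ.outerColumn_strictAnti hj hi hij).ne

theorem innerCorners_eq (μ : StrictPartition) :
    μ.innerCorners = insert (μ.length, μ.length + 1)
      (μ.cornerRows.image fun i => (μ.lastCornerRow i, i + μ.row i)) := by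
  have h1 : μ.outerCorners.sup Prod.fst = μ.length := by
    rw [outerCorners_eq_image, Finset.sup_image, ← μ.sup_cornerRows]
    rfl
  have h2 : ∀ i, (μ.outerCorners.filter fun a => a.1 < i).sup Prod.fst = μ.lastCornerRow i := by
    intro i
    rw [outerCorners_eq_image, Finset.filter_image, Finset.sup_image]
    rfl
  rw [innerCorners, h1]
  simp only [h2]
  rw [outerCorners_eq_image, Finset.image_image]
  rfl

/-- The inner corner `(ℓ, ℓ + 1)` has content `1` and contributes `binom(1, 2)^k`, which is zero as
`k ≠ 0`. Any other inner corner has content one more than the first row of the run ending at its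
corner row. -/
theorem q_eq (μ : StrictPartition) {k : ℕ} (hk : k ≠ 0) :
    q k μ = ∑ i ∈ μ.cornerRows,
      ((((μ.row (μ.lastCornerRow i + 1) + 1).choose 2 : ℕ) : ℚ) ^ k
        - (((μ.row i).choose 2 : ℕ) : ℚ) ^ k) := by
  rw [q, innerCorners_eq, Finset.sum_insert, Finset.sum_image, outerCorners_eq_image,
    Finset.sum_image, Finset.sum_sub_distrib]
  · have h0 : (((content (μ.length, μ.length + 1)).choose 2 : ℕ) : ℚ) ^ k = 0 := by
      simp [content, hk]
    rw [h0, zero_add]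
    congr 1
    · refine Finset.sum_congr rfl fun i hi => ?_
      rw [mem_cornerRows] at hi
      have := μ.lastCornerRow_add_row hi.1.1 hi.1.2
      have : content (μ.lastCornerRow i, i + μ.row i) = μ.row (μ.lastCornerRow i + 1) + 1 := by
        simp only [content]
        omega
      rw [this]
    · refine Finset.sum_congr rfl fun i hi => ?_
      rw [content, Nat.add_sub_cancel_left]
  · intro i _ j _ h
    exact congrArg Prod.fst h
  · intro i hi j hj h
    exact μ.outerColumn_injOn hi hj (congrArg Prod.snd h)
  · intro h
    obtain ⟨i, hi, h⟩ := Finset.mem_image.mp h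
    rw [Prod.mk.injEq] at h
    rw [mem_cornerRows] at hi
    have := μ.lastCornerRow_lt hi.1.1
    omega

/-- Inside a run `μ_i = μ_{i+1} + 1`, so the row terms telescope to the difference between the inner
and the outer corner of that run. -/
theorem q_eq_sum_rows (μ : StrictPartition) {k : ℕ} (hk : k ≠ 0) :
    q k μ = ∑ i ∈ Finset.Icc 1 μ.length,
      ((((μ.row i + 1).choose 2 : ℕ) : ℚ) ^ k - (((μ.row i).choose 2 : ℕ) : ℚ) ^ k) := by
  set g : ℕ → ℚ := fun a => ((a.choose 2 : ℕ) : ℚ) ^ k with hg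
  -- The last bracket is the telescoped part of a run not finished at row `m`; it vanishes when `m`
  -- is a corner row, in particular at the end.
  have key : ∀ m, m ≤ μ.length → ∑ i ∈ Finset.Icc 1 m, (g (μ.row i + 1) - g (μ.row i))
      = ∑ i ∈ μ.cornerRows.filter (fun i => i < m + 1),
          (g (μ.row (μ.lastCornerRow i + 1) + 1) - g (μ.row i))
        + (g (μ.row (μ.lastCornerRow (m + 1) + 1) + 1) - g (μ.row (m + 1) + 1)) := by
    intro m hm
    induction m with
    | zero =>
      rw [Finset.filter_eq_empty_iff.mpr fun i hi => by
        have := (μ.mem_cornerRows i).mp hi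
        omega, zero_add, lastCornerRow_one]
      simp
    | succ m ih =>
      rw [Finset.sum_Icc_succ_top (by omega), ih (by omega)]
      by_cases h : m + 1 ∈ μ.cornerRows
      · have hf : μ.cornerRows.filter (fun i => i < m + 1 + 1)
            = insert (m + 1) (μ.cornerRows.filter fun i => i < m + 1) := by
          ext i
          simp only [Finset.mem_filter, Finset.mem_insert]
          constructor
          · rintro ⟨h1, h2⟩
            by_cases h3 : i = m + 1
            · exact Or.inl h3
            · exact Or.inr ⟨h1, by omega⟩
          · rintro (rfl | ⟨h1, h2⟩)
            · exact ⟨h, by omega⟩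
            · exact ⟨h1, by omega⟩
        rw [hf, Finset.sum_insert (by simp), μ.lastCornerRow_succ_of_mem h]
        ring
      · have hf : μ.cornerRows.filter (fun i => i < m + 1 + 1)
            = μ.cornerRows.filter fun i => i < m + 1 := by
          refine Finset.filter_congr fun i hi => ?_
          have : i ≠ m + 1 := fun hc => h (hc ▸ hi)
          omega
        rw [hf, μ.lastCornerRow_succ_of_notMem h,
          (μ.row_eq_of_notMem_cornerRows (by omega) hm h).1]
        ring
  have hall : μ.cornerRows.filter (fun i => i < μ.length + 1) = μ.cornerRows :=
    Finset.filter_true_of_mem fun i hi => by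
      have := (μ.mem_cornerRows i).mp hi
      omega
  have hlast : μ.lastCornerRow (μ.length + 1) = μ.length := by
    rw [lastCornerRow, hall, sup_cornerRows]
  rw [q_eq _ hk, key _ le_rfl, hall, hlast, sub_self, add_zero]

theorem q_two_eq (μ : StrictPartition) {L : ℕ} (hL : μ.length ≤ L) :
    q 2 μ = ∑ i ∈ Finset.Icc 1 L, (μ.row i : ℚ) ^ 3 := by
  rw [q_eq_sum_rows _ two_ne_zero]
  refine Finset.sum_subset_zero_on_sdiff (Finset.Icc_subset_Icc_right hL) ?_ ?_
  · intro i hi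
    rw [Finset.mem_sdiff, Finset.mem_Icc, Finset.mem_Icc] at hi
    rw [μ.row_eq_zero (by omega)]
    norm_num
  · intro i _
    rw [Nat.cast_choose_two, Nat.cast_choose_two]
    push_cast
    ring

theorem IsRaise.q_two_eq {μ ν : StrictPartition} {i : ℕ} (h : μ.IsRaise i ν) :
    q 2 ν = q 2 μ + 6 * μ.node i + 1 := by
  rw [ν.q_two_eq h.length_le, h.sum_eq (fun a => (a : ℚ) ^ 3), ← μ.q_two_eq (Nat.le_succ _), node]
  push_cast
  ring

/-! ### Content sums and one-step averages -/

/-- The sum of `binom(c + 1, 4)` over the contents `c` of all boxes. -/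
def contentSum (μ : StrictPartition) : ℚ := ∑ b ∈ μ.boxes, (((content b + 1).choose 4 : ℕ) : ℚ)

theorem cast_choose_four (a : ℕ) :
    (((a + 2).choose 4 : ℕ) : ℚ) = (a + 2) * (a + 1) * a * (a - 1) / 24 := by
  have h3 : ∀ a : ℕ, (((a + 2).choose 3 : ℕ) : ℚ) = (a + 2) * (a + 1) * a / 6 := by
    intro a
    induction a with
    | zero => simp [Nat.choose]
    | succ a ih =>
      rw [show a + 1 + 2 = (a + 2) + 1 by ring, Nat.choose_succ_succ', Nat.cast_add, ih,
        Nat.cast_choose_two]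
      push_cast
      ring
  induction a with
  | zero => simp [Nat.choose]
  | succ a ih =>
    rw [show a + 1 + 2 = (a + 2) + 1 by ring, Nat.choose_succ_succ', Nat.cast_add, ih, h3]
    push_cast
    ring

theorem IsRaise.contentSum_eq {μ ν : StrictPartition} {i : ℕ} (h : μ.IsRaise i ν) :
    ν.contentSum = μ.contentSum + (μ.node i ^ 2 - μ.node i) / 6 := by
  have hc : content (i, i + μ.row i + 1) + 1 = μ.row i + 2 := by
    simp only [content]
    omega
  rw [contentSum, h.boxes_eq, Finset.sum_insert (IsRaise.notMem_boxes μ i), hc, cast_choose_four,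
    ← contentSum, node]
  ring

/-- The three moments of the one-box weights: total mass `1`, first moment `|μ|`, second moment
`(|μ|^2 + q_2(μ))/2`. -/
theorem sum_relWeight_mul_of_quadratic (μ : StrictPartition) (G : StrictPartition → ℚ)
    (a b c : ℚ) (hG : ∀ i ν, μ.IsRaise i ν → G ν = a + b * μ.node i + c * μ.node i ^ 2) :
    ∑ ν ∈ μ.extensions 1, μ.relWeight ν * G ν
      = a + b * μ.size + c * ((μ.size ^ 2 + q 2 μ) / 2) := by
  have hI : Finset.Icc 1 (μ.length + 1) = insert (μ.length + 1) (Finset.Icc 1 μ.length) := by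
    ext k
    simp only [Finset.mem_insert, Finset.mem_Icc]
    omega
  obtain ⟨h0, h1, h2⟩ := dividedDiff_prod_moments (s := Finset.Icc 1 μ.length)
    (o := μ.length + 1) (by simp) (x := μ.node) μ.root (hI ▸ μ.node_injOn)
    (by rw [node, μ.row_eq_zero (lt_add_one _)]; simp)
  have e1 : ∑ j ∈ Finset.Icc 1 μ.length, (μ.node j - μ.root j) = μ.size := by
    rw [μ.size_eq_sum_row le_rfl, Nat.cast_sum]
    refine Finset.sum_congr rfl fun j _ => ?_
    rw [node, root]
    ring
  have e2 : ∑ j ∈ Finset.Icc 1 μ.length, (μ.node j ^ 2 - μ.root j ^ 2) = q 2 μ := by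
    rw [μ.q_two_eq le_rfl]
    refine Finset.sum_congr rfl fun j _ => ?_
    rw [node, root]
    ring
  rw [e1] at h1
  rw [e1, e2] at h2
  rw [μ.sum_relWeight_mul G (fun z => a + b * z + c * z ^ 2) hG, hI]
  have hsplit : (fun z => (a + b * z + c * z ^ 2) * ∏ j ∈ Finset.Icc 1 μ.length, (z - μ.root j))
      = fun z => (a * ∏ j ∈ Finset.Icc 1 μ.length, (z - μ.root j)
        + b * (z * ∏ j ∈ Finset.Icc 1 μ.length, (z - μ.root j)))
        + c * (z * (z * ∏ j ∈ Finset.Icc 1 μ.length, (z - μ.root j))) := by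
    ext z
    ring
  rw [hsplit, dividedDiff_add, dividedDiff_add, dividedDiff_const_mul, dividedDiff_const_mul,
    dividedDiff_const_mul, h0, h1]
  linear_combination c / 2 * h2

/-! ### Averages over `n` added boxes -/

/-- The weighted sum of `F` over all extensions of `μ` by `n` boxes. -/
noncomputable def weightedSum (μ : StrictPartition) (n : ℕ) (F : StrictPartition → ℚ) : ℚ :=
  ∑ ν ∈ μ.extensions n, (ν.numTableaux μ : ℚ) * (μ.relWeight ν * F ν)

theorem weightedSum_zero (μ : StrictPartition) (F : StrictPartition → ℚ) :
    μ.weightedSum 0 F = F μ := by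
  rw [weightedSum, extensions_zero, Finset.sum_singleton, numTableaux_self, relWeight_self,
    Nat.cast_one, one_mul, one_mul]

/-- Relative weights multiply along chains, so the tableau recursion makes the last added box a
separate one-step average. -/
theorem weightedSum_succ (μ : StrictPartition) (n : ℕ) (F : StrictPartition → ℚ) :
    μ.weightedSum (n + 1) F
      = μ.weightedSum n fun κ => ∑ ν ∈ κ.extensions 1, κ.relWeight ν * F ν := by
  rw [weightedSum, sum_extensions_succ, weightedSum]
  refine Finset.sum_congr rfl fun κ _ => ?_
  congr 1
  rw [Finset.mul_sum]
  refine Finset.sum_congr rfl fun ν _ => ?_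
  rw [← mul_assoc, relWeight_mul]

theorem weightedSum_congr (μ : StrictPartition) (n : ℕ) {F G : StrictPartition → ℚ}
    (h : ∀ κ, κ.size = μ.size + n → F κ = G κ) : μ.weightedSum n F = μ.weightedSum n G :=
  Finset.sum_congr rfl fun κ hκ => by rw [h κ ((mem_extensions _ _ _).mp hκ).2]

theorem weightedSum_add (μ : StrictPartition) (n : ℕ) (F G : StrictPartition → ℚ) :
    μ.weightedSum n (fun κ => F κ + G κ) = μ.weightedSum n F + μ.weightedSum n G := by
  simp only [weightedSum, mul_add, Finset.sum_add_distrib]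

theorem weightedSum_const_mul (μ : StrictPartition) (n : ℕ) (c : ℚ) (F : StrictPartition → ℚ) :
    μ.weightedSum n (fun κ => c * F κ) = c * μ.weightedSum n F := by
  rw [weightedSum, weightedSum, Finset.mul_sum]
  exact Finset.sum_congr rfl fun κ _ => by ring

theorem weightedSum_one (μ : StrictPartition) (n : ℕ) : μ.weightedSum n (fun _ => 1) = 1 := by
  induction n with
  | zero => rw [weightedSum_zero]
  | succ n ih =>
    rw [weightedSum_succ]
    refine (weightedSum_congr μ n fun κ _ => ?_).trans ih
    rw [κ.sum_relWeight_mul_of_quadratic _ 1 0 0 fun i ν _ => by ring]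
    ring

theorem weightedSum_const (μ : StrictPartition) (n : ℕ) (c : ℚ) :
    μ.weightedSum n (fun _ => c) = c := by
  simpa only [mul_one, weightedSum_one] using μ.weightedSum_const_mul n c fun _ => 1

theorem weightedSum_q_two (μ : StrictPartition) (n : ℕ) :
    μ.weightedSum n (q 2) = q 2 μ + 6 * μ.size * n + 6 * (n.choose 2 : ℚ) + n := by
  induction n with
  | zero => rw [weightedSum_zero]; simp
  | succ n ih =>
    -- A step raises `q_2` by `6X + 1`, whose mean is `6|κ| + 1`, and `|κ| = |μ| + n` is constant
    -- over the sum.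
    rw [weightedSum_succ, weightedSum_congr μ n (G := fun κ => q 2 κ + (6 * (μ.size + n) + 1)),
      weightedSum_add, weightedSum_const, ih, Nat.cast_choose_two, Nat.cast_choose_two]
    · push_cast
      ring
    · intro κ hκ
      rw [κ.sum_relWeight_mul_of_quadratic _ (q 2 κ + 1) 6 0
        fun i ν h => by rw [h.q_two_eq]; ring, hκ]
      push_cast
      ring

theorem weightedSum_contentSum (μ : StrictPartition) (n : ℕ) :
    μ.weightedSum n contentSum = μ.contentSum
      + (2 / 3 * (n.choose 3 : ℚ) + 2 / 3 * (μ.size : ℚ) * (n.choose 2 : ℚ)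
        + 1 / 12 * (q 2 μ + (μ.size : ℚ) ^ 2 - 2 * (μ.size : ℚ)) * (n : ℚ)) := by
  induction n with
  | zero => rw [weightedSum_zero]; simp
  | succ n ih =>
    -- The mean of `(X^2 - X)/6` is `(|κ|^2 + q_2(κ))/12 - |κ|/6`; only the `q_2` term varies with
    -- `κ`, and its average is already known.
    rw [weightedSum_succ, weightedSum_congr μ n (G := fun κ => contentSum κ
      + (1 / 12 * q 2 κ + (((μ.size : ℚ) + n) ^ 2 / 12 - ((μ.size : ℚ) + n) / 6))),
      weightedSum_add, weightedSum_add, weightedSum_const, weightedSum_const_mul, ih,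
      weightedSum_q_two, Nat.choose_succ_succ' n 2, Nat.cast_add, Nat.cast_choose_two ℚ (n + 1),
      Nat.cast_choose_two]
    · push_cast
      ring
    · intro κ hκ
      rw [κ.sum_relWeight_mul_of_quadratic _ κ.contentSum (-1 / 6) (1 / 6)
        fun i ν h => by rw [h.contentSum_eq]; ring, hκ]
      push_cast
      ring

end StrictPartition

theorem mainTheorem5 (μ : StrictPartition) (n : ℕ) :
    ∑ ν ∈ μ.extensions n,
      (2 : ℚ) ^ ((ν.size : ℤ) - ν.length - μ.size + μ.length)
        * (StrictPartition.numTableaux ν μ : ℚ) * (μ.hookProd : ℚ) / (ν.hookProd : ℚ)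
        * (∑ b ∈ ν.boxes, (((StrictPartition.content b + 1).choose 4 : ℕ) : ℚ)
            - ∑ b ∈ μ.boxes, (((StrictPartition.content b + 1).choose 4 : ℕ) : ℚ))
      = 2 / 3 * (n.choose 3 : ℚ) + 2 / 3 * (μ.size : ℚ) * (n.choose 2 : ℚ)
        + 1 / 12 * (StrictPartition.q 2 μ + (μ.size : ℚ) ^ 2 - 2 * (μ.size : ℚ)) * (n : ℚ) := by
  -- The total weight is `1`, so subtracting the content sum of `μ` inside the average removes
  -- exactly that constant.
  have h := StrictPartition.weightedSum_add μ n StrictPartition.contentSum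
    fun _ => -μ.contentSum
  rw [StrictPartition.weightedSum_contentSum, StrictPartition.weightedSum_const,
    add_neg_cancel_comm] at h
  rw [← h]
  refine Finset.sum_congr rfl fun ν _ => ?_
  simp only [StrictPartition.relWeight, StrictPartition.contentSum]
  ring
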